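/- **Conventions.** $\hat f(\xi)=\int f(x)e^{-2\pi i\,\xi^{T}x}\,dx$, extended to a unitary operator on $L^2$. **Generators.** Let $\phi\in\mathcal S(\mathbb R)$ satisfy $0\le\hat\phi\le 1$, $\hat\phi=1$ on $[-\tfrac1{16},\tfrac1{16}]$ and $\operatorname{supp}\hat\phi\subset[-\tfrac18,\tfrac18]$. For $\xi\in\mathbb R^2$ put $$\hat\Phi(\xi)=\hat\phi(\xi_1)\hat\phi(\xi_2),\qquad W(\xi)=\sqrt{\hat\Phi(2^{-2}\xi)^2-\hat\Phi(\xi)^2}.$$ Let $v\in C^\infty(\mathbb R)$ satisfy $\operatorname{supp}v\subset[-1,1]$, $|v(u-1)|^2+|v(u)|^2+|v(u+1)|^2=1$ for $u\in[-1,1]$, $v(0)=1$ and $v^{(n)}(0)=0$ for all $n\ge1$. Put $V_{h}(\xi)=v(\xi_2/\xi_1)$, $V_{v}(\xi)=v(\xi_1/\xi_2)$ (read as $0$ where the denominator vanishes), $C_h=\{|\xi_2|\le|\xi_1|\}$, $C_v=\{|\xi_1|\le|\xi_2|\}$, and $$A_{\alpha,h}=\begin{pmatrix}2^2&0\\0&2^\alpha\end{pmatrix},\quad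 A_{\alpha,v}=\begin{pmatrix}2^\alpha&0\\0&2^2\end{pmatrix},\quad S_h=\begin{pmatrix}1&1\\0&1\end{pmatrix},\quad S_v=\begin{pmatrix}1&0\\1&1\end{pmatrix}.$$ **Scaling sequence.** A real sequence $(\alpha_j)_{j\ge0}$ with $\alpha_0=0$ and $\alpha_j\in\{m/j : m\in\mathbb Z,\ m\le 2j-1\}$ for $j\ge1$. **Universal shearlet system.** $SH(\phi,v,(\alpha_j))$ is the family consisting of the following functions, where $k$ ranges over $\mathbb Z^2$ and $j$ over the integers $\ge0$. 1. *Coarse scaling functions*: $\psi_{-1,k}(x)=\Phi(x-k)$. 2. *Interior shearlets*, for $\iota\in\{h,v\}$ and $l\in\mathbb Z$ with $|l|<2^{(2-\alpha_j)j}$: $$\hat\psi^{\iota}_{j,l,k}(\xi)=2^{-(2+\alpha_j)j/2}\,W(2^{-2j}\xi)\,V_\iota\big(\xi^TA_{\alpha_j,\iota}^{-j}S_\iota^{-l}\big)\,e^{-2\pi i\,\xi^TA_{\alpha_j,\iota}^{-j}S_\iota^{-l}k}.$$ 3. *Boundary shearlets*, for $l=\pm2^{(2-\alpha_j)j}$: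 if $j\ge1$, then for $\xi\in C_\iota$, $\iota\in\{h,v\}$, $$\hat\psi_{j,l,k}(\xi)=2^{-(2+\alpha_j)j/2-1}\,W(2^{-2j}\xi)\,V_\iota\big(\xi^TA_{\alpha_j,\iota}^{-j}S_\iota^{-l}\big)\,e^{-\pi i\,\xi^TA_{\alpha_j,h}^{-j}S_h^{-l}k}$$ (with the horizontal modulation on both cones); if $j=0$, then for $\xi\in C_\iota$, $\hat\psi_{0,l,k}(\xi)=W(\xi)\,V_\iota(\xi^TS_\iota^{-l})\,e^{-2\pi i\,\xi^Tk}$. **Theorem.** Let $\phi,v$ be as above and let $(\alpha_j)$ be any scaling sequence. Then all elements of $SH(\phi,v,(\alpha_j))$ lie in $L^2(\mathbb R^2)$, the system is a Parseval frame for $L^2(\mathbb R^2)$, i.e. $\sum_{\psi}|\langle f,\psi\rangle|^2=\|f\|^2$ for all $f\in L^2(\mathbb R^2)$, and every element is band-limited (its Fourier transform has compact support). If moreover $\phi$ is chosen such that $W\in C^\infty(\mathbb R^2)$, then every element is a Schwartz function, and all interior and boundary shearlets $\psi$ have infinitely many vanishing moments: $\int_{\mathbb R^2}x_1^m x_2^n\,\psi(x)\,dx=0$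 for all integers $m,n\ge0$. -/

import Mathlib

open MeasureTheory FourierTransform
open scoped ContDiff SchwartzMap Matrix

noncomputable section

namespace UniversalShearlet

/-- The Euclidean plane `ℝ²`. -/
abbrev Plane : Type := EuclideanSpace ℝ (Fin 2)

/-! ### Frames, band-limited functions, vanishing moments -/

/-- A family `(ψ i)` in a Hilbert space is a Parseval frame (a frame with both bounds equal to `1`)
if `∑ i, |⟨f, ψ i⟩|² = ‖f‖²` for every `f`. -/
def IsParsevalFrame {ι H : Type*} [NormedAddCommGroup H] [InnerProductSpace ℂ H]
    (ψ : ι → H) : Prop :=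
  ∀ f : H, HasSum (fun i => ‖inner ℂ (ψ i) f‖ ^ 2) (‖f‖ ^ 2)

/-- An element of `L²(ℝ²)` is band-limited if its (Plancherel) Fourier transform vanishes almost
everywhere outside a compact set. -/
def IsBandLimited (f : Lp ℂ 2 (volume : Measure Plane)) : Prop :=
  ∃ K : Set Plane, IsCompact K ∧
    ∀ᵐ ξ ∂(volume : Measure Plane), ξ ∉ K → (𝓕 f : Lp ℂ 2 (volume : Measure Plane)) ξ = 0

/-- `f` is (the function underlying) a Schwartz function. -/
def IsSchwartz (f : Plane → ℂ) : Prop := ∃ g : 𝓢(Plane, ℂ), ⇑g = f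

/-- Infinitely many vanishing moments: all polynomial moments exist and are zero. -/
def HasInfinitelyManyVanishingMoments (f : Plane → ℂ) : Prop :=
  ∀ m n : ℕ,
    Integrable (fun x : Plane => ((x 0 ^ m * x 1 ^ n : ℝ) : ℂ) * f x) volume ∧
    ∫ x : Plane, ((x 0 ^ m * x 1 ^ n : ℝ) : ℂ) * f x = 0

/-! ### The generating functions -/

/-- A Meyer scaling function: `φ ∈ 𝓢(ℝ)` with `0 ≤ φ̂ ≤ 1`, `φ̂ = 1` on `[-1/16, 1/16]` and
`supp φ̂ ⊆ [-1/8, 1/8]`. -/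
structure IsMeyerScaling (φ : 𝓢(ℝ, ℂ)) : Prop where
  im_eq_zero : ∀ u : ℝ, (𝓕 φ u).im = 0
  nonneg : ∀ u : ℝ, 0 ≤ (𝓕 φ u).re
  le_one : ∀ u : ℝ, (𝓕 φ u).re ≤ 1
  eq_one : ∀ u ∈ Set.Icc (-(1 / 16) : ℝ) (1 / 16), 𝓕 φ u = 1
  tsupport_subset : tsupport (fun u : ℝ => 𝓕 φ u) ⊆ Set.Icc (-(1 / 8) : ℝ) (1 / 8)

/-- The bump-like function `v`. -/
structure IsBump (v : ℝ → ℂ) : Prop where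
  contDiff : ContDiff ℝ ∞ v
  tsupport_subset : tsupport v ⊆ Set.Icc (-1 : ℝ) 1
  sum_sq : ∀ u ∈ Set.Icc (-1 : ℝ) 1, ‖v (u - 1)‖ ^ 2 + ‖v u‖ ^ 2 + ‖v (u + 1)‖ ^ 2 = 1
  map_zero : v 0 = 1
  iteratedDeriv_zero : ∀ n : ℕ, 1 ≤ n → iteratedDeriv n v 0 = 0

/-- A scaling sequence: `α 0 = 0` and `α j ∈ {m / j : m ∈ ℤ, m ≤ 2 j - 1}` for `j ≥ 1`. -/
def IsScalingSequence (α : ℕ → ℝ) : Prop :=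
  α 0 = 0 ∧ ∀ j : ℕ, 1 ≤ j → ∃ m : ℤ, m ≤ 2 * (j : ℤ) - 1 ∧ α j = (m : ℝ) / (j : ℝ)

/-- `Φ̂(ξ) = φ̂(ξ₁) φ̂(ξ₂)`, a real number (the values of `φ̂` are real for a Meyer scaling
function). -/
def scalHat (φ : 𝓢(ℝ, ℂ)) (ξ : Plane) : ℝ := (𝓕 φ (ξ 0)).re * (𝓕 φ (ξ 1)).re

/-- The corona function `W(ξ) = √(Φ̂(2⁻² ξ)² - Φ̂(ξ)²)`. The radicand is nonnegative for a Meyer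
scaling function. -/
def corona (φ : 𝓢(ℝ, ℂ)) (ξ : Plane) : ℝ :=
  Real.sqrt (scalHat φ (((2 : ℝ) ^ 2)⁻¹ • ξ) ^ 2 - scalHat φ ξ ^ 2)

/-! ### Cones, scaling and shearing matrices -/

/-- The two directions: horizontal and vertical. -/
inductive Dir
  | hor
  | ver

/-- The scaling matrices `diag(2², 2^α)` and `diag(2^α, 2²)`. -/
def scalMat (α : ℝ) : Dir → Matrix (Fin 2) (Fin 2) ℝ
  | .hor => !![(2 : ℝ) ^ 2, 0; 0, (2 : ℝ) ^ α]
  | .ver => !![(2 : ℝ) ^ α, 0; 0, (2 : ℝ) ^ 2]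

/-- The shearing matrices. -/
def shearMat : Dir → Matrix (Fin 2) (Fin 2) ℝ
  | .hor => !![1, 1; 0, 1]
  | .ver => !![1, 0; 1, 1]

/-- The row vector `ξᵀ A⁻ʲ S⁻ˡ`. -/
def warp (α : ℝ) (d : Dir) (j : ℕ) (l : ℤ) (ξ : Plane) : Fin 2 → ℝ :=
  ξ.ofLp ᵥ* (scalMat α d ^ (-(j : ℤ)) * shearMat d ^ (-l))

/-- The cone functions `V(ξ) = v(ξ₂ / ξ₁)` (horizontal) and `V(ξ) = v(ξ₁ / ξ₂)` (vertical). On the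
line where the denominator vanishes, the value is `0`, in accordance with the compact support
of `v`. -/
def coneFun (v : ℝ → ℂ) : Dir → (Fin 2 → ℝ) → ℂ
  | .hor, ξ => if ξ 0 = 0 then 0 else v (ξ 1 / ξ 0)
  | .ver, ξ => if ξ 1 = 0 then 0 else v (ξ 0 / ξ 1)

/-- The character `exp(-2π i s η·k)`, for `η ∈ ℝ²`, `k ∈ ℤ²`. -/
def phase (s : ℝ) (η : Fin 2 → ℝ) (k : Fin 2 → ℤ) : ℂ :=
  Complex.exp (-(2 * Real.pi * s * (η ⬝ᵥ fun i => (k i : ℝ)) : ℝ) * Complex.I)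

/-! ### Elements of the universal shearlet system -/

/-- The Fourier transform of the interior shearlet `ψ^{α,d}_{j,l,k}`. -/
def interiorHat (φ : 𝓢(ℝ, ℂ)) (v : ℝ → ℂ) (α : ℝ) (d : Dir) (j : ℕ) (l : ℤ) (k : Fin 2 → ℤ)
    (ξ : Plane) : ℂ :=
  ((2 : ℝ) ^ (-((2 + α) * j / 2)) : ℝ) * (corona φ (((2 : ℝ) ^ (2 * j))⁻¹ • ξ) : ℂ) *
    coneFun v d (warp α d j l ξ) * phase 1 (warp α d j l ξ) k

/-- The Fourier transform of the boundary shearlet `ψ^{α}_{j,l,k}`. The two formulas, on the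
horizontal cone `|ξ₂| ≤ |ξ₁|` and on the vertical cone `|ξ₁| ≤ |ξ₂|`, agree on the intersection of
the cones for `l = ± 2 ^ ((2 - α) j)`. The modulation is the horizontal one on both cones. -/
def boundaryHat (φ : 𝓢(ℝ, ℂ)) (v : ℝ → ℂ) (α : ℝ) (j : ℕ) (l : ℤ) (k : Fin 2 → ℤ)
    (ξ : Plane) : ℂ :=
  let V : ℂ := if |ξ 1| ≤ |ξ 0| then coneFun v .hor (warp α .hor j l ξ)
    else coneFun v .ver (warp α .ver j l ξ)
  if j = 0 then
    (corona φ ξ : ℂ) * V * phase 1 ξ.ofLp k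
  else
    ((2 : ℝ) ^ (-((2 + α) * j / 2) - 1) : ℝ) * (corona φ (((2 : ℝ) ^ (2 * j))⁻¹ • ξ) : ℂ) *
      V * phase (1 / 2) (warp α .hor j l ξ) k

/-- The index set of the universal shearlet system of the scaling sequence `α`. -/
inductive Index (α : ℕ → ℝ) : Type
  | coarse (k : Fin 2 → ℤ) : Index α
  | interior (d : Dir) (j : ℕ) (l : ℤ) (hl : |(l : ℝ)| < (2 : ℝ) ^ ((2 - α j) * j))
      (k : Fin 2 → ℤ) : Index α
  | boundary (j : ℕ) (l : ℤ) (hl : |(l : ℝ)| = (2 : ℝ) ^ ((2 - α j) * j))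
      (k : Fin 2 → ℤ) : Index α

/-- The indices of interior and boundary shearlets. -/
def Index.IsShearlet {α : ℕ → ℝ} : Index α → Prop
  | .coarse _ => False
  | .interior _ _ _ _ _ => True
  | .boundary _ _ _ _ => True

/-- The universal shearlet system `SH(φ, v, α)`: the coarse scaling functions are the integer
translates of `Φ`, the other elements are given by their Fourier representation. -/
def unish (φ : 𝓢(ℝ, ℂ)) (v : ℝ → ℂ) (α : ℕ → ℝ) : Index α → Plane → ℂ
  | .coarse k => fun x =>
      𝓕⁻ (fun ξ : Plane => (scalHat φ ξ : ℂ)) (x - WithLp.toLp 2 fun i => (k i : ℝ))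
  | .interior d j l _ k => 𝓕⁻ (interiorHat φ v (α j) d j l k)
  | .boundary j l _ k => 𝓕⁻ (boundaryHat φ v (α j) j l k)

end UniversalShearlet

end

/-! Everything is read off on the Fourier side. Up to the lattice parameter `k`, each element has a
transform of the form `c · g(ξ) · exp(-2πi ξᵀM k)` with `c² = |det M|`, where the profile `g` is
bounded by 1 and lives where `ξᵀM` lies in the closed unit square centred at 0
(`abs_rowMap_le_of_profile_ne_zero`, `amp_sq`). Parseval for Fourier series on that square then
turns the sum over `k` of the squared coefficients of `f` into `∫ |g|² |f̂|²`
(`hasSum_sq_integral_generator`).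

The frame property thus reduces to `∑ |g|² = 1` almost everywhere. Radially, the squares of the
corona functions telescope (`hasSum_corona_sq`). On level `j`, the number `2^((2-α_j)j)` is a
positive integer, so off the diagonals the horizontal, vertical and boundary cone functions together
are exactly the integer translates of `v` evaluated at one slope, whose squares sum to 1
(`hasSum_level`). Tonelli concludes.

For smooth `W`, the only critical places are the origin, where `W` vanishes identically nearby, and
the diagonals, where the two formulas of a boundary shearlet are glued; the gluing is smooth because
`v` is flat at 0 (`contDiffAt_edgeFun`). The transforms are then smooth with compact support, so the
elements are Schwartz. Since shearlet transforms vanish near 0, so do all their derivatives, which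
gives the vanishing moments. -/

noncomputable section

namespace UniversalShearlet

/-! ### The Fourier transform on `L¹ ∩ L²` -/

section FourierL1L2

variable {E : Type*} [NormedAddCommGroup E] [InnerProductSpace ℝ E] [FiniteDimensional ℝ E]
  [MeasurableSpace E] [BorelSpace E]

lemma continuous_fourierInv {g : E → ℂ} (hg : Integrable g) : Continuous (𝓕⁻ g) := by
  have : Continuous fun p : E × E => (-innerₗ E) p.1 p.2 := by
    change Continuous fun p : E × E => -inner ℝ p.1 p.2
    fun_prop
  exact VectorFourier.fourierIntegral_continuous Real.continuous_fourierChar this hg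

lemma integral_fourierInv_smul_eq {f g : E → ℂ} (hf : Integrable f) (hg : Integrable g) :
    ∫ x, 𝓕⁻ f x • g x = ∫ x, f x • 𝓕⁻ g x := by
  have : Continuous fun p : E × E => (-innerₗ E) p.1 p.2 := by
    change Continuous fun p : E × E => -inner ℝ p.1 p.2
    fun_prop
  have h := VectorFourier.integral_fourierIntegral_smul_eq_flip (L := -innerₗ E)
    Real.continuous_fourierChar this hf hg
  have hflip : (-innerₗ E).flip = -innerₗ E := by
    ext x y
    simp [real_inner_comm]
  rw [hflip] at h
  exact h

/-- On `L¹ ∩ L²` the Plancherel inverse Fourier transform is given by the Fourier integral. -/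
theorem fourierInv_toLp_ae_eq {g : E → ℂ} (h1 : Integrable g) (h2 : MemLp g 2) :
    (𝓕⁻ (h2.toLp g) : Lp ℂ 2 (volume : Measure E)) =ᵐ[volume] 𝓕⁻ g := by
  -- Both sides are locally integrable, so it suffices to pair them with test functions. The
  -- transform moves onto the test function on the left by its distributional definition, on the
  -- right by Fubini.
  refine ae_eq_of_integral_contDiff_smul_eq
    ((Lp.memLp _).locallyIntegrable one_le_two)
    (continuous_fourierInv h1).locallyIntegrable ?_
  intro χ hχ hc
  have hc' : HasCompactSupport (Complex.ofRealCLM ∘ χ) := hc.comp_left rfl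
  have hχ' : ContDiff ℝ ∞ (Complex.ofRealCLM ∘ χ) := by fun_prop
  set H : 𝓢(E, ℂ) := hc'.toSchwartzMap hχ' with hH
  have hHx : ∀ x, H x = (χ x : ℂ) := fun x => rfl
  have e1 : ∫ x, H x • (𝓕⁻ (h2.toLp g) : Lp ℂ 2 (volume : Measure E)) x
      = ∫ x, (𝓕⁻ H) x • (h2.toLp g) x := by
    rw [← Lp.toTemperedDistribution_apply, ← Lp.fourierInv_toTemperedDistribution_eq,
      TemperedDistribution.fourierInv_apply, Lp.toTemperedDistribution_apply]
  have e2 : ∫ x, (𝓕⁻ H) x • (h2.toLp g) x = ∫ x, (𝓕⁻ H) x • g x := by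
    refine integral_congr_ae ?_
    filter_upwards [h2.coeFn_toLp] with x hx
    rw [hx]
  have e3 : ∫ x, (𝓕⁻ H) x • g x = ∫ x, H x • 𝓕⁻ g x := by
    rw [SchwartzMap.fourierInv_coe]
    exact integral_fourierInv_smul_eq H.integrable h1
  have e4 := e1.trans (e2.trans e3)
  simpa only [hHx, smul_eq_mul, Complex.real_smul] using e4

lemma memLp_fourierInv {g : E → ℂ} (h1 : Integrable g) (h2 : MemLp g 2) : MemLp (𝓕⁻ g) 2 :=
  (memLp_congr_ae (fourierInv_toLp_ae_eq h1 h2)).1 (Lp.memLp _)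

lemma toLp_fourierInv {g : E → ℂ} (h1 : Integrable g) (h2 : MemLp g 2) (h3 : MemLp (𝓕⁻ g) 2) :
    h3.toLp (𝓕⁻ g) = 𝓕⁻ (h2.toLp g) := by
  refine Lp.ext ?_
  exact h3.coeFn_toLp.trans (fourierInv_toLp_ae_eq h1 h2).symm

lemma inner_toLp_fourierInv {g : E → ℂ} (h1 : Integrable g) (h2 : MemLp g 2)
    (h3 : MemLp (𝓕⁻ g) 2) (f : Lp ℂ 2 (volume : Measure E)) :
    inner ℂ (h3.toLp (𝓕⁻ g)) f
      = ∫ ξ, (starRingEnd ℂ) (g ξ) * (𝓕 f : Lp ℂ 2 (volume : Measure E)) ξ := by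
  rw [toLp_fourierInv h1 h2 h3, ← Lp.inner_fourier_eq, FourierTransform.fourier_fourierInv_eq,
    L2.inner_def]
  refine integral_congr_ae ?_
  filter_upwards [h2.coeFn_toLp] with x hx
  rw [hx, RCLike.inner_apply, mul_comm]

end FourierL1L2

/-! ### Vanishing moments -/

/-- Up to a nonzero constant, multiplication by a linear form is differentiation of the transform,
and a function that is zero near a point has zero derivative near it. -/
lemma eventuallyEq_fourier_smulLeftCLM {E : Type*} [NormedAddCommGroup E] [InnerProductSpace ℝ E]
    [FiniteDimensional ℝ E] [MeasurableSpace E] [BorelSpace E] {f : 𝓢(E, ℂ)} {x₀ : E}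
    (hf : ∀ᶠ ξ in nhds x₀, 𝓕 f ξ = 0) (m : E) :
    ∀ᶠ ξ in nhds x₀, 𝓕 (SchwartzMap.smulLeftCLM ℂ (inner ℝ · m) f) ξ = 0 := by
  have h := SchwartzMap.lineDerivOp_fourier_eq f m
  rw [FourierTransform.fourier_smul] at h
  filter_upwards [hf.eventually_nhds] with ξ hξ
  have h1 := congrArg (fun F : 𝓢(E, ℂ) => F ξ) h
  simp only [SchwartzMap.lineDerivOp_apply_eq_fderiv, _root_.smul_apply] at h1
  have h2 : fderiv ℝ (⇑(𝓕 f : 𝓢(E, ℂ))) ξ = 0 := by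
    have : (⇑(𝓕 f : 𝓢(E, ℂ))) =ᶠ[nhds ξ] fun _ => (0 : ℂ) := hξ
    rw [this.fderiv_eq]
    simp
  rw [h2] at h1
  simpa [Real.pi_ne_zero] using h1.symm

/-- Vanishing on a neighbourhood, not merely at 0, is what survives differentiation; keeping it in
the conclusion lets the lemma be applied to the two coordinates in turn. -/
lemma exists_schwartz_moment {f : 𝓢(Plane, ℂ)} (hf : ∀ᶠ ξ in nhds (0 : Plane), 𝓕 f ξ = 0)
    (i : Fin 2) (n : ℕ) :
    ∃ g : 𝓢(Plane, ℂ), (∀ᶠ ξ in nhds (0 : Plane), 𝓕 g ξ = 0) ∧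
      ∀ x : Plane, g x = ((x i ^ n : ℝ) : ℂ) * f x := by
  induction n with
  | zero => exact ⟨f, hf, by simp⟩
  | succ n ih =>
    obtain ⟨g, hg, hgx⟩ := ih
    refine ⟨_, eventuallyEq_fourier_smulLeftCLM hg (EuclideanSpace.single i 1), fun x => ?_⟩
    have : (fun x : Plane => inner ℝ x (EuclideanSpace.single i (1 : ℝ))).HasTemperateGrowth := by
      fun_prop
    rw [SchwartzMap.smulLeftCLM_apply_apply this, hgx]
    simp [EuclideanSpace.inner_single_right, pow_succ]
    ring

theorem hasInfinitelyManyVanishingMoments_of_fourier {f : 𝓢(Plane, ℂ)}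
    (hf : ∀ᶠ ξ in nhds (0 : Plane), 𝓕 f ξ = 0) :
    HasInfinitelyManyVanishingMoments f := by
  intro m n
  obtain ⟨g, hg, hgx⟩ := exists_schwartz_moment hf 1 n
  obtain ⟨h, hh, hhx⟩ := exists_schwartz_moment hg 0 m
  have e : (fun x : Plane => ((x 0 ^ m * x 1 ^ n : ℝ) : ℂ) * f x) = h := by
    ext x
    rw [hhx, hgx]
    push_cast
    ring
  rw [e]
  refine ⟨h.integrable, ?_⟩
  -- The integral of `h` is its Fourier transform at 0.
  have := hh.self_of_nhds
  rw [SchwartzMap.fourier_coe, Real.fourier_eq] at this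
  simpa using this

/-! ### One-sided modification of a flat function -/

/-- The derivative of the truncation is the truncation of `deriv g`, which is again flat at 0; hence
induction on the order, with `g` generalized. -/
lemma contDiff_ite_le_of_iteratedDeriv_eq_zero {g : ℝ → ℂ} (hg : ContDiff ℝ ∞ g)
    (h0 : ∀ n, iteratedDeriv n g 0 = 0) : ContDiff ℝ ∞ (fun u => if u ≤ 0 then g u else 0) := by
  have key : ∀ g : ℝ → ℂ, ContDiff ℝ ∞ g → (∀ n, iteratedDeriv n g 0 = 0) → ∀ u,
      HasDerivAt (fun u => if u ≤ 0 then g u else 0) (if u ≤ 0 then deriv g u else 0) u := by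
    intro g hg h0 u
    have hd : Differentiable ℝ g := hg.differentiable (by simp)
    rcases lt_trichotomy u 0 with hu | rfl | hu
    · rw [if_pos hu.le]
      refine (hd u).hasDerivAt.congr_of_eventuallyEq ?_
      filter_upwards [Iio_mem_nhds hu] with y hy
      exact if_pos (le_of_lt hy)
    · have g0 : g 0 = 0 := by simpa using h0 0
      have g1 : deriv g 0 = 0 := by simpa using h0 1
      rw [if_pos le_rfl, g1]
      have h := (hd 0).hasDerivAt
      rw [g1, hasDerivAt_iff_isLittleO] at h
      rw [hasDerivAt_iff_isLittleO]
      -- The truncated function is pointwise no larger than `g`, which is `o(y)` at 0.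
      refine Asymptotics.IsBigO.trans_isLittleO ?_ h
      refine Asymptotics.isBigO_of_le _ fun y => ?_
      by_cases hy : y ≤ 0 <;> simp [hy, g0]
    · rw [if_neg (not_le.2 hu)]
      refine (hasDerivAt_const u (0 : ℂ)).congr_of_eventuallyEq ?_
      filter_upwards [Ioi_mem_nhds hu] with y hy
      exact if_neg (not_le.2 hy)
  have main : ∀ n : ℕ, ∀ g : ℝ → ℂ, ContDiff ℝ ∞ g → (∀ n, iteratedDeriv n g 0 = 0) →
      ContDiff ℝ n (fun u => if u ≤ 0 then g u else 0) := by
    intro n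
    induction n with
    | zero =>
      intro g hg h0
      exact contDiff_zero.2 (continuous_iff_continuousAt.2 fun u => (key g hg h0 u).continuousAt)
    | succ n ih =>
      intro g hg h0
      have hg' : ContDiff ℝ ∞ (deriv g) := (contDiff_infty_iff_deriv.1 hg).2
      have h0' : ∀ n, iteratedDeriv n (deriv g) 0 = 0 := fun n => by
        rw [← iteratedDeriv_succ']
        exact h0 (n + 1)
      refine (contDiff_succ_iff_deriv (n := (n : ℕ∞ω))).2
        ⟨fun u => (key g hg h0 u).differentiableAt, by simp, ?_⟩
      have : deriv (fun u => if u ≤ 0 then g u else 0) = fun u => if u ≤ 0 then deriv g u else 0 :=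
        funext fun u => (key g hg h0 u).deriv
      rw [this]
      exact ih _ hg' h0'
  exact contDiff_infty.2 fun n => main n g hg h0

lemma contDiff_ite_le_of_iteratedDeriv {g : ℝ → ℂ} (hg : ContDiff ℝ ∞ g)
    (h0 : ∀ n, 1 ≤ n → iteratedDeriv n g 0 = 0) :
    ContDiff ℝ ∞ (fun u => if u ≤ 0 then g u else g 0) := by
  have h1 : ContDiff ℝ ∞ (fun u => g u - g 0) := hg.sub contDiff_const
  have h2 : ∀ n, iteratedDeriv n (fun u => g u - g 0) 0 = 0 := by
    intro n
    rcases Nat.eq_zero_or_pos n with rfl | hn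
    · simp
    · obtain ⟨n, rfl⟩ := Nat.exists_eq_succ_of_ne_zero hn.ne'
      have : deriv (fun u => g u - g 0) = deriv g := by
        ext u
        simp
      rw [iteratedDeriv_succ', this, ← iteratedDeriv_succ']
      exact h0 _ hn
  have h3 := (contDiff_ite_le_of_iteratedDeriv_eq_zero h1 h2).add (contDiff_const (c := g 0))
  convert h3 using 2 with u
  by_cases hu : u ≤ 0 <;> simp [hu]

lemma contDiff_ite_ge_of_iteratedDeriv {g : ℝ → ℂ} (hg : ContDiff ℝ ∞ g)
    (h0 : ∀ n, 1 ≤ n → iteratedDeriv n g 0 = 0) :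
    ContDiff ℝ ∞ (fun u => if 0 ≤ u then g u else g 0) := by
  have h1 : ContDiff ℝ ∞ (fun u => g (-u)) := hg.comp contDiff_neg
  have h2 : ∀ n, 1 ≤ n → iteratedDeriv n (fun u => g (-u)) 0 = 0 := by
    intro n hn
    rw [iteratedDeriv_comp_neg]
    simp [h0 n hn]
  have h3 := (contDiff_ite_le_of_iteratedDeriv h1 h2).comp contDiff_neg
  convert h3 using 2 with u
  by_cases hu : 0 ≤ u <;> simp [hu]

/-! ### Parseval's identity for Fourier series on a square -/

/-- The half-open square `(-1/2, 1/2]²`. -/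
def square : Set (Fin 2 → ℝ) := {x | ∀ i, x i ∈ Set.Ioc (-(1 / 2) : ℝ) (-(1 / 2) + 1)}

lemma measurableSet_square : MeasurableSet square :=
  MeasurableSet.univ_pi' fun _ => measurableSet_Ioc

lemma square_ae_eq : square =ᵐ[volume] Set.Icc (fun _ => -(1 / 2) : Fin 2 → ℝ) (fun _ => 1 / 2) := by
  have h : square = Set.univ.pi fun _ : Fin 2 => Set.Ioc (-(1 / 2) : ℝ) (1 / 2) := by
    ext x
    norm_num [square]
  rw [h]
  exact Measure.univ_pi_Ioc_ae_eq_Icc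

attribute [local instance] instMeasureSpaceUnitAddCircle

/-- The section of the quotient map `ℝ² → ℝ²/ℤ²` with values in the square. -/
def torusSection (t : UnitAddTorus (Fin 2)) : Fin 2 → ℝ :=
  (UnitAddTorus.measurableEquivPiIoc (fun _ => -(1 / 2) : Fin 2 → ℝ) t).1

lemma measurableEmbedding_torusSection : MeasurableEmbedding torusSection :=
  (MeasurableEmbedding.subtype_coe measurableSet_square).comp
    (UnitAddTorus.measurableEquivPiIoc _).measurableEmbedding

lemma measurePreserving_torusSection :
    MeasurePreserving torusSection volume (volume.restrict square) := by
  have h1 := UnitAddTorus.measurePreserving_equivPiIoc (fun _ => -(1 / 2) : Fin 2 → ℝ)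
  have h2 : MeasurePreserving (Subtype.val : square → Fin 2 → ℝ)
      (Measure.comap Subtype.val volume) (volume.restrict square) :=
    ⟨measurable_subtype_coe, map_comap_subtype_coe measurableSet_square _⟩
  exact h2.comp h1

lemma coe_torusSection (t : UnitAddTorus (Fin 2)) :
    (fun i => (torusSection t i : UnitAddCircle)) = t :=
  (UnitAddTorus.measurableEquivPiIoc (fun _ => -(1 / 2) : Fin 2 → ℝ)).symm_apply_apply t

lemma phase_eq_mFourier (η : Fin 2 → ℝ) (k : Fin 2 → ℤ) :
    phase 1 η k = UnitAddTorus.mFourier (-k) (fun i => (η i : UnitAddCircle)) := by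
  simp only [UnitAddTorus.mFourier, ContinuousMap.coe_mk, fourier_coe_apply, Fin.prod_univ_two,
    ← Complex.exp_add, phase, dotProduct, Fin.sum_univ_two]
  congr 1
  push_cast [Pi.neg_apply]
  ring

/-- A function carried by the unit square is a function on the torus, and these integrals are its
Fourier coefficients: the minus sign in `phase` is the one in the definition of the coefficient. -/
theorem hasSum_sq_integral_phase {F : (Fin 2 → ℝ) → ℂ} (hF : MemLp F 2 volume)
    (hsupp : ∀ᵐ η, η ∉ square → F η = 0) :
    HasSum (fun k : Fin 2 → ℤ => ‖∫ η, phase 1 η k * F η‖ ^ 2) (∫ η, ‖F η‖ ^ 2) := by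
  have hm : MemLp (F ∘ torusSection) 2 volume :=
    (hF.restrict square).comp_measurePreserving measurePreserving_torusSection
  have h := UnitAddTorus.hasSum_sq_mFourierCoeff (hm.toLp _)
  have tr : ∀ {V : Type} [NormedAddCommGroup V] [NormedSpace ℝ V] (G : (Fin 2 → ℝ) → V),
      (∀ᵐ η, η ∉ square → G η = 0) → ∫ t, G (torusSection t) = ∫ η, G η := by
    intro V _ _ G hG
    rw [measurePreserving_torusSection.integral_comp measurableEmbedding_torusSection]
    exact setIntegral_eq_integral_of_ae_compl_eq_zero hG
  have e1 : ∀ k, UnitAddTorus.mFourierCoeff (hm.toLp (F ∘ torusSection)) k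
      = ∫ η, phase 1 η k * F η := by
    intro k
    rw [← tr (fun η => phase 1 η k * F η) (by filter_upwards [hsupp] with η h hη; simp [h hη])]
    refine integral_congr_ae ?_
    filter_upwards [hm.coeFn_toLp] with t ht
    rw [ht, phase_eq_mFourier, coe_torusSection]
    rfl
  have e2 : ∫ t, ‖(hm.toLp (F ∘ torusSection)) t‖ ^ 2 = ∫ η, ‖F η‖ ^ 2 := by
    rw [← tr (fun η => ‖F η‖ ^ 2) (by filter_upwards [hsupp] with η h hη; simp [h hη])]
    refine integral_congr_ae ?_
    filter_upwards [hm.coeFn_toLp] with t ht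
    rw [ht]
    rfl
  simpa only [e1, e2] using h

/-! ### Linear changes of variables -/

section LinearChange

variable {M : Matrix (Fin 2) (Fin 2) ℝ}

/-- The map `ξ ↦ ξᵀ M` on the plane. -/
def rowMap (M : Matrix (Fin 2) (Fin 2) ℝ) (ξ : Plane) : Fin 2 → ℝ := ξ.ofLp ᵥ* M

lemma measurableEmbedding_rowMap (hM : M.det ≠ 0) : MeasurableEmbedding (rowMap M) := by
  have h : Continuous (rowMap M) := by
    unfold rowMap
    fun_prop
  refine h.measurableEmbedding fun x y hxy => ?_
  have hu : IsUnit M := (Matrix.isUnit_iff_isUnit_det M).2 hM.isUnit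
  have := Matrix.vecMul_injective_of_isUnit hu hxy
  exact WithLp.ofLp_injective 2 this

lemma map_rowMap (hM : M.det ≠ 0) :
    Measure.map (rowMap M) volume = ENNReal.ofReal |M.det⁻¹| • volume := by
  have h1 : rowMap M = Matrix.toLin' Mᵀ ∘ WithLp.ofLp := by
    ext ξ
    simp [rowMap, Matrix.mulVec_transpose]
  have h2 := (PiLp.volume_preserving_ofLp (Fin 2)).map_eq
  rw [h1, ← Measure.map_map (by fun_prop) (by fun_prop), h2,
    Real.map_matrix_volume_pi_eq_smul_volume_pi (by rwa [Matrix.det_transpose]),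
    Matrix.det_transpose]

lemma integral_comp_rowMap {V : Type*} [NormedAddCommGroup V] [NormedSpace ℝ V] (hM : M.det ≠ 0)
    (G : (Fin 2 → ℝ) → V) :
    ∫ ξ, G (rowMap M ξ) = |M.det|⁻¹ • ∫ η, G η := by
  rw [← (measurableEmbedding_rowMap hM).integral_map, map_rowMap hM, integral_smul_measure,
    ENNReal.toReal_ofReal (abs_nonneg _), abs_inv]

/-- Parseval's identity for the exponentials `exp (2 π i ξᵀ M k)` on the preimage of the unit
square under `ξ ↦ ξᵀ M`. -/
theorem hasSum_sq_integral_phase_rowMap (hM : M.det ≠ 0) {F : Plane → ℂ} (hF : MemLp F 2 volume)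
    (hsupp : ∀ ξ, F ξ ≠ 0 → ∀ i, |rowMap M ξ i| ≤ 1 / 2) :
    HasSum (fun k : Fin 2 → ℤ => |M.det| * ‖∫ ξ, phase 1 (rowMap M ξ) k * F ξ‖ ^ 2)
      (∫ ξ, ‖F ξ‖ ^ 2) := by
  have hu : IsUnit M.det := hM.isUnit
  -- `G` is `F` in the coordinate `η = ξᵀM`, where the lattice becomes `ℤ²`.
  set G : (Fin 2 → ℝ) → ℂ := fun η => F (WithLp.toLp 2 (η ᵥ* M⁻¹)) with hG
  have hGr : ∀ ξ, G (rowMap M ξ) = F ξ := by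
    intro ξ
    simp [hG, rowMap, Matrix.vecMul_vecMul, Matrix.mul_nonsing_inv _ hu]
  have hrG : ∀ η, rowMap M (WithLp.toLp 2 (η ᵥ* M⁻¹)) = η := by
    intro η
    simp [rowMap, Matrix.vecMul_vecMul, Matrix.nonsing_inv_mul _ hu]
  have hd : 0 < |M.det| := abs_pos.2 hM
  have hGm : MemLp G 2 volume := by
    have h1 : MemLp G 2 (Measure.map (rowMap M) volume) := by
      rw [(measurableEmbedding_rowMap hM).memLp_map_measure_iff]
      exact hF.congr_norm (hF.1.congr (by filter_upwards with ξ using (hGr ξ).symm))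
        (by filter_upwards with ξ; simp [hGr])
    rw [map_rowMap hM] at h1
    refine h1.of_measure_le_smul (c := ENNReal.ofReal |M.det|) (by simp) ?_
    rw [smul_smul, ← ENNReal.ofReal_mul hd.le, ← abs_mul, mul_inv_cancel₀ hM]
    simp
  -- The support bound gives the closed square, which differs from the half-open one by a null set.
  have hGs : ∀ᵐ η, η ∉ square → G η = 0 := by
    filter_upwards [square_ae_eq.mem_iff] with η hη hns
    by_contra hne
    refine hns (hη.2 ?_)
    have := hsupp _ hne
    rw [hrG] at this
    exact ⟨fun i => (abs_le.1 (this i)).1, fun i => (abs_le.1 (this i)).2⟩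
  have h := (hasSum_sq_integral_phase hGm hGs).mul_left |M.det|⁻¹
  have e1 : ∫ ξ, ‖F ξ‖ ^ 2 = |M.det|⁻¹ * ∫ η, ‖G η‖ ^ 2 := by
    rw [← smul_eq_mul, ← integral_comp_rowMap hM]
    simp only [hGr]
  have e2 : ∀ k, ∫ ξ, phase 1 (rowMap M ξ) k * F ξ
      = |M.det|⁻¹ • ∫ η, phase 1 η k * G η := by
    intro k
    rw [← integral_comp_rowMap hM]
    simp only [hGr]
  rw [e1]
  -- The Jacobian enters squared in each coefficient and once in the norm, leaving one factor
  -- `|M.det|` on the coefficient side.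
  refine h.congr_fun fun k => ?_
  rw [e2, norm_smul, norm_inv, Real.norm_eq_abs, abs_abs]
  field_simp

lemma phase_neg (s : ℝ) (η : Fin 2 → ℝ) (k : Fin 2 → ℤ) :
    phase s η (-k) = (starRingEnd ℂ) (phase s η k) := by
  rw [phase, phase, ← Complex.exp_conj]
  congr 1
  rw [map_mul, map_neg, Complex.conj_ofReal, Complex.conj_I]
  simp [dotProduct]
  ring

lemma phase_smul (s : ℝ) (η : Fin 2 → ℝ) (k : Fin 2 → ℤ) :
    phase 1 (s • η) k = phase s η k := by
  simp [phase, smul_dotProduct]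
  ring_nf

lemma norm_phase (s : ℝ) (η : Fin 2 → ℝ) (k : Fin 2 → ℤ) : ‖phase s η k‖ = 1 := by
  rw [phase, ← Complex.ofReal_neg, Complex.norm_exp_ofReal_mul_I]

/-- The Parseval identity of a single generator `g`, modulated by a lattice. -/
theorem hasSum_sq_integral_generator (hM : M.det ≠ 0) {c : ℝ} (hc : c ^ 2 = |M.det|)
    {g : Plane → ℂ} (hg : AEStronglyMeasurable g volume) {B : ℝ} (hB : ∀ ξ, ‖g ξ‖ ≤ B)
    (hsupp : ∀ ξ, g ξ ≠ 0 → ∀ i, |rowMap M ξ i| ≤ 1 / 2)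
    {F : Plane → ℂ} (hF : MemLp F 2 volume) :
    HasSum (fun k : Fin 2 → ℤ =>
        ‖∫ ξ, (starRingEnd ℂ) (c * g ξ * phase 1 (rowMap M ξ) k) * F ξ‖ ^ 2)
      (∫ ξ, ‖g ξ‖ ^ 2 * ‖F ξ‖ ^ 2) := by
  have hgc : AEStronglyMeasurable (fun ξ => (starRingEnd ℂ) (g ξ)) volume :=
    Complex.continuous_conj.comp_aestronglyMeasurable hg
  have hm : MemLp (fun ξ => (starRingEnd ℂ) (g ξ) * F ξ) 2 volume := by
    refine MemLp.of_le_mul (c := B) hF (hgc.mul hF.1) ?_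
    filter_upwards with ξ
    rw [norm_mul, RCLike.norm_conj]
    exact mul_le_mul_of_nonneg_right (hB ξ) (norm_nonneg _)
  have hs : ∀ ξ, (starRingEnd ℂ) (g ξ) * F ξ ≠ 0 → ∀ i, |rowMap M ξ i| ≤ 1 / 2 := by
    intro ξ hξ
    refine hsupp ξ fun h => hξ ?_
    simp [h]
  have h := hasSum_sq_integral_phase_rowMap hM hm hs
  simp only [norm_mul, mul_pow, RCLike.norm_conj] at h
  -- The inner product conjugates the phase, which amounts to `k ↦ -k`.
  rw [← (Equiv.neg (Fin 2 → ℤ)).hasSum_iff] at h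
  refine h.congr_fun fun k => ?_
  simp only [Function.comp_apply, Equiv.neg_apply, phase_neg]
  have : ∀ ξ, (starRingEnd ℂ) (c * g ξ * phase 1 (rowMap M ξ) k) * F ξ
      = c * ((starRingEnd ℂ) (phase 1 (rowMap M ξ) k) * ((starRingEnd ℂ) (g ξ) * F ξ)) := by
    intro ξ
    simp only [map_mul, Complex.conj_ofReal]
    ring
  simp only [this]
  rw [integral_const_mul, norm_mul, mul_pow, Complex.norm_real, Real.norm_eq_abs, sq_abs, hc]

end LinearChange

/-! ### The scaling function and the corona function -/

section Corona

variable {φ : 𝓢(ℝ, ℂ)}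

lemma IsMeyerScaling.eq_zero (hφ : IsMeyerScaling φ) {u : ℝ} (hu : 1 / 8 < |u|) : 𝓕 φ u = 0 := by
  by_contra h
  have h1 := hφ.tsupport_subset (subset_tsupport _ h)
  exact absurd (abs_le.2 ⟨h1.1, h1.2⟩) (not_le.2 hu)

lemma scalHat_nonneg (hφ : IsMeyerScaling φ) (ξ : Plane) : 0 ≤ scalHat φ ξ :=
  mul_nonneg (hφ.nonneg _) (hφ.nonneg _)

lemma scalHat_le_one (hφ : IsMeyerScaling φ) (ξ : Plane) : scalHat φ ξ ≤ 1 :=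
  mul_le_one₀ (hφ.le_one _) (hφ.nonneg _) (hφ.le_one _)

lemma scalHat_eq_one (hφ : IsMeyerScaling φ) {ξ : Plane} (h : ∀ i, |ξ i| ≤ 1 / 16) :
    scalHat φ ξ = 1 := by
  have h1 : ∀ i, 𝓕 φ (ξ i) = 1 := fun i => hφ.eq_one _ (abs_le.1 (h i))
  simp [scalHat, h1]

lemma abs_le_of_scalHat_ne_zero (hφ : IsMeyerScaling φ) {ξ : Plane} (h : scalHat φ ξ ≠ 0) (i : Fin 2) :
    |ξ i| ≤ 1 / 8 := by
  by_contra hi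
  have h1 := hφ.eq_zero (not_le.1 hi)
  refine h ?_
  fin_cases i <;> simp_all [scalHat]

lemma contDiff_scalHat : ContDiff ℝ ∞ (scalHat φ) := by
  have h : ContDiff ℝ ∞ (𝓕 φ : 𝓢(ℝ, ℂ)) := (𝓕 φ : 𝓢(ℝ, ℂ)).smooth ⊤
  have h1 : ContDiff ℝ ∞ fun u : ℝ => ((𝓕 φ : 𝓢(ℝ, ℂ)) u).re :=
    Complex.reCLM.contDiff.comp h
  unfold scalHat
  have h2 : ∀ i : Fin 2, ContDiff ℝ ∞ fun ξ : Plane => ξ i := fun i => by fun_prop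
  exact (h1.comp (h2 0)).mul (h1.comp (h2 1))

lemma continuous_corona : Continuous (corona φ) := by
  have := (contDiff_scalHat (φ := φ)).continuous
  unfold corona
  fun_prop

lemma corona_nonneg (ξ : Plane) : 0 ≤ corona φ ξ := Real.sqrt_nonneg _

/-- The radicand is nonnegative: where `Φ̂(ξ) ≠ 0` the coordinates are at most 1/8, so those of
`ξ/4` are at most 1/32 and `Φ̂(ξ/4) = 1`. -/
lemma corona_sq (hφ : IsMeyerScaling φ) (ξ : Plane) :
    corona φ ξ ^ 2 = scalHat φ (((2 : ℝ) ^ 2)⁻¹ • ξ) ^ 2 - scalHat φ ξ ^ 2 := by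
  refine Real.sq_sqrt (sub_nonneg.2 ?_)
  by_cases h : scalHat φ ξ = 0
  · rw [h]
    simpa using sq_nonneg _
  · have h1 : scalHat φ (((2 : ℝ) ^ 2)⁻¹ • ξ) = 1 := by
      refine scalHat_eq_one hφ fun i => ?_
      have := abs_le_of_scalHat_ne_zero hφ h i
      simp only [PiLp.smul_apply, smul_eq_mul, abs_mul]
      norm_num
      linarith
    rw [h1]
    exact pow_le_pow_left₀ (scalHat_nonneg hφ _) (scalHat_le_one hφ _) 2

lemma corona_le_one (hφ : IsMeyerScaling φ) (ξ : Plane) : corona φ ξ ≤ 1 := by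
  refine (sq_le_one_iff₀ (corona_nonneg ξ)).1 ?_
  rw [corona_sq hφ]
  have := pow_le_one₀ (n := 2) (scalHat_nonneg hφ (((2 : ℝ) ^ 2)⁻¹ • ξ)) (scalHat_le_one hφ _)
  nlinarith [sq_nonneg (scalHat φ ξ)]

/-- The bound is `4 · 1/8`, exactly half the side of the unit square on which Fourier series are
used. -/
lemma abs_le_of_corona_ne_zero (hφ : IsMeyerScaling φ) {ξ : Plane} (h : corona φ ξ ≠ 0) (i : Fin 2) :
    |ξ i| ≤ 1 / 2 := by
  have h1 : scalHat φ (((2 : ℝ) ^ 2)⁻¹ • ξ) ≠ 0 := by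
    intro h0
    have h2 := corona_sq hφ ξ
    rw [h0] at h2
    have : 0 < corona φ ξ ^ 2 := by positivity
    nlinarith [sq_nonneg (scalHat φ ξ)]
  have h2 := abs_le_of_scalHat_ne_zero hφ h1 i
  simp only [PiLp.smul_apply, smul_eq_mul, abs_mul] at h2
  norm_num at h2
  linarith

lemma corona_eq_zero (hφ : IsMeyerScaling φ) {ξ : Plane} (h : ∀ i, |ξ i| ≤ 1 / 16) :
    corona φ ξ = 0 := by
  have h1 : scalHat φ (((2 : ℝ) ^ 2)⁻¹ • ξ) = 1 := by
    refine scalHat_eq_one hφ fun i => ?_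
    have := h i
    simp only [PiLp.smul_apply, smul_eq_mul, abs_mul]
    norm_num
    linarith [abs_nonneg (ξ i)]
  simp [corona, h1, scalHat_eq_one hφ h]

/-- This hole at the origin serves twice: it hides the singularity of the cone functions and
produces the vanishing moments. -/
lemma corona_eventually_eq_zero (hφ : IsMeyerScaling φ) (a : ℝ) :
    ∀ᶠ ξ in nhds (0 : Plane), corona φ (a • ξ) = 0 := by
  have h : ∀ i : Fin 2, ∀ᶠ ξ in nhds (0 : Plane), |(a • ξ) i| < 1 / 16 := by
    intro i
    have hc : Continuous fun ξ : Plane => |(a • ξ) i| := by fun_prop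
    exact hc.continuousAt.eventually_lt continuousAt_const (by simp)
  filter_upwards [h 0, h 1] with ξ h0 h1
  refine corona_eq_zero hφ fun i => ?_
  fin_cases i
  exacts [h0.le, h1.le]

/-- The squared corona functions and the squared scaling function form a partition of unity. -/
lemma hasSum_corona_sq (hφ : IsMeyerScaling φ) (ξ : Plane) :
    HasSum (fun j : ℕ => corona φ (((2 : ℝ) ^ (2 * j))⁻¹ • ξ) ^ 2) (1 - scalHat φ ξ ^ 2) := by
  -- The partial sums telescope, and become constant once the dilated point enters the box where `Φ̂
  -- = 1`.
  have hsum : ∀ n : ℕ, ∑ j ∈ Finset.range n, corona φ (((2 : ℝ) ^ (2 * j))⁻¹ • ξ) ^ 2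
      = scalHat φ (((2 : ℝ) ^ (2 * n))⁻¹ • ξ) ^ 2 - scalHat φ ξ ^ 2 := by
    intro n
    induction n with
    | zero => simp
    | succ n ih =>
      rw [Finset.sum_range_succ, ih, corona_sq hφ, smul_smul, ← mul_inv, ← pow_add,
        show 2 + 2 * n = 2 * (n + 1) by ring]
      ring
  rw [hasSum_iff_tendsto_nat_of_nonneg fun _ => sq_nonneg _]
  simp only [hsum]
  refine tendsto_const_nhds.congr' ?_
  have h : ∀ i : Fin 2, ∀ᶠ n : ℕ in Filter.atTop, |(((2 : ℝ) ^ (2 * n))⁻¹ • ξ) i| < 1 / 16 := by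
    intro i
    have h1 : Filter.Tendsto (fun n : ℕ => |(((2 : ℝ) ^ (2 * n))⁻¹ • ξ) i|) Filter.atTop (nhds 0) := by
      have h2 : Filter.Tendsto (fun n : ℕ => ((2 : ℝ) ^ (2 * n))⁻¹) Filter.atTop (nhds 0) := by
        simp only [pow_mul, ← inv_pow]
        exact tendsto_pow_atTop_nhds_zero_of_lt_one (by norm_num) (by norm_num)
      simpa using (h2.mul_const (ξ i)).abs
    exact h1.eventually_lt_const (by norm_num)
  filter_upwards [h 0, h 1] with n h0 h1
  rw [scalHat_eq_one hφ (ξ := ((2 : ℝ) ^ (2 * n))⁻¹ • ξ)]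
  · simp
  · intro i
    fin_cases i
    exacts [h0.le, h1.le]

end Corona

/-! ### The bump function -/

section Bump

variable {v : ℝ → ℂ}

/-- The endpoints `±1`, not excluded by the support condition, follow by continuity from outside. -/
lemma IsBump.eq_zero (hv : IsBump v) {u : ℝ} (hu : 1 ≤ |u|) : v u = 0 := by
  have h1 : ∀ u : ℝ, 1 < |u| → v u = 0 := by
    intro u hu
    by_contra h
    have h1 := hv.tsupport_subset (subset_tsupport _ h)
    exact absurd (abs_le.2 ⟨h1.1, h1.2⟩) (not_le.2 hu)
  rcases hu.lt_or_eq with h | h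
  · exact h1 u h
  · have hc : Continuous v := hv.contDiff.continuous
    have hs : ∀ s : ℝ, 1 < s → v (s * u) = 0 := fun s hs => h1 _ (by
      rw [abs_mul, ← h, mul_one]
      exact hs.trans_le (le_abs_self s))
    have h2 : Filter.Tendsto (fun s : ℝ => v (s * u)) (nhdsWithin 1 (Set.Ioi 1)) (nhds (v (1 * u))) :=
      (Continuous.tendsto (by fun_prop) 1).mono_left nhdsWithin_le_nhds
    have h3 : Filter.Tendsto (fun s : ℝ => v (s * u)) (nhdsWithin 1 (Set.Ioi 1)) (nhds 0) :=
      tendsto_const_nhds.congr' (by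
        filter_upwards [self_mem_nhdsWithin] with s hs'
        exact (hs s hs').symm)
    simpa using tendsto_nhds_unique h2 h3

lemma IsBump.norm_le_one (hv : IsBump v) (u : ℝ) : ‖v u‖ ≤ 1 := by
  by_cases hu : u ∈ Set.Icc (-1 : ℝ) 1
  · have := hv.sum_sq u hu
    rw [← sq_le_one_iff₀ (norm_nonneg _)]
    nlinarith [sq_nonneg ‖v (u - 1)‖, sq_nonneg ‖v (u + 1)‖]
  · rw [hv.eq_zero]
    · simp
    · by_contra h
      have := abs_lt.1 (not_le.1 h)
      exact hu ⟨this.1.le, this.2.le⟩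

/-- The squared integer translates of `v` form a partition of unity. -/
lemma IsBump.hasSum_sq (hv : IsBump v) (u : ℝ) : HasSum (fun l : ℤ => ‖v (u - l)‖ ^ 2) 1 := by
  set n := ⌊u⌋ with hn
  have h0 : (n : ℝ) ≤ u := Int.floor_le u
  have h1 : u < n + 1 := Int.lt_floor_add_one u
  -- As `u - n` lies in `[0, 1)`, only the translates by `n` and `n + 1` can be nonzero.
  have hs := hv.sum_sq (u - n) ⟨by linarith, by linarith⟩
  rw [hv.eq_zero (u := u - n + 1) (by rw [abs_of_nonneg] <;> linarith)] at hs
  have h := hasSum_sum_of_ne_finset_zero (L := .unconditional ℤ)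
    (f := fun l : ℤ => ‖v (u - l)‖ ^ 2) (s := {n, n + 1}) ?_
  · rw [Finset.sum_pair (by simp)] at h
    convert h using 1
    push_cast
    rw [show u - (n + 1 : ℝ) = u - n - 1 by ring]
    simp at hs
    linarith
  · intro l hl
    simp only [Finset.mem_insert, Finset.mem_singleton, not_or] at hl
    have : 1 ≤ |u - l| := by
      rcases lt_or_gt_of_ne hl.1 with h | h
      · have : (l : ℝ) + 1 ≤ n := by exact_mod_cast h
        exact (by linarith : 1 ≤ u - l).trans (le_abs_self _)
      · have h2 : n + 1 < l := lt_of_le_of_ne h (Ne.symm hl.2)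
        have : (n : ℝ) + 1 + 1 ≤ l := by exact_mod_cast h2
        exact (by linarith : 1 ≤ -(u - l)).trans (neg_le_abs _)
    simp [hv.eq_zero this]

end Bump

/-! ### The warping matrices -/

section Warp

lemma diag_zpow_neg (x y : ℝ) (j : ℕ) (hx : x ≠ 0) (hy : y ≠ 0) :
    (!![x, 0; 0, y] : Matrix (Fin 2) (Fin 2) ℝ) ^ (-(j : ℤ)) = !![(x ^ j)⁻¹, 0; 0, (y ^ j)⁻¹] := by
  have h : ∀ j : ℕ, (!![x, 0; 0, y] : Matrix (Fin 2) (Fin 2) ℝ) ^ j = !![x ^ j, 0; 0, y ^ j] := by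
    intro j
    induction j with
    | zero => simp [Matrix.one_fin_two]
    | succ j ih => simp [pow_succ, ih]
  rw [Matrix.zpow_neg_natCast, h]
  refine Matrix.inv_eq_left_inv ?_
  simp [Matrix.one_fin_two, hx, hy]

lemma shear_hor_zpow (l : ℤ) : shearMat .hor ^ l = !![1, (l : ℝ); 0, 1] := by
  have hd : IsUnit (shearMat .hor).det := by simp [shearMat, Matrix.det_fin_two]
  have hm : ∀ x y : ℝ, !![1, x; 0, 1] * !![1, y; 0, 1] = !![1, y + x; 0, 1] := by
    intro x y
    simp
  have hi : (shearMat .hor)⁻¹ = !![1, -1; 0, 1] :=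
    Matrix.inv_eq_left_inv (by rw [shearMat, hm]; simp [Matrix.one_fin_two])
  induction l using Int.induction_on with
  | zero => simp [Matrix.one_fin_two]
  | succ n ih =>
    rw [Matrix.zpow_add_one hd, ih, shearMat, hm]
    push_cast
    ring_nf
  | pred n ih =>
    rw [Matrix.zpow_sub_one hd, ih, hi, hm]
    push_cast
    ring_nf

lemma shear_ver_zpow (l : ℤ) : shearMat .ver ^ l = !![1, 0; (l : ℝ), 1] := by
  have hd : IsUnit (shearMat .ver).det := by simp [shearMat, Matrix.det_fin_two]
  have hm : ∀ x y : ℝ, !![1, 0; x, 1] * !![1, 0; y, 1] = !![1, 0; x + y, 1] := by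
    intro x y
    simp
  have hi : (shearMat .ver)⁻¹ = !![1, 0; -1, 1] :=
    Matrix.inv_eq_left_inv (by rw [shearMat, hm]; simp [Matrix.one_fin_two])
  induction l using Int.induction_on with
  | zero => simp [Matrix.one_fin_two]
  | succ n ih =>
    rw [Matrix.zpow_add_one hd, ih, shearMat, hm]
    push_cast
    ring_nf
  | pred n ih =>
    rw [Matrix.zpow_sub_one hd, ih, hi, hm]
    push_cast
    ring_nf

/-- The matrix `A⁻ʲ S⁻ˡ`. -/
def warpMat (α : ℝ) (d : Dir) (j : ℕ) (l : ℤ) : Matrix (Fin 2) (Fin 2) ℝ :=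
  scalMat α d ^ (-(j : ℤ)) * shearMat d ^ (-l)

/-- The number of shears, `2 ^ ((2 - α) j)`. -/
def shearBound (α : ℝ) (j : ℕ) : ℝ := (2 : ℝ) ^ ((2 - α) * j)

/-- The isotropic dilation factor `2 ^ (-2j)`. -/
def dil (j : ℕ) : ℝ := ((2 : ℝ) ^ (2 * j))⁻¹

lemma dil_pos (j : ℕ) : 0 < dil j := by
  unfold dil
  positivity

lemma shearBound_pos (α : ℝ) (j : ℕ) : 0 < shearBound α j := by
  unfold shearBound
  positivity

/-- This extracts the isotropic dilation from the anisotropic scaling; what remains is the number of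
shears, multiplying the slope. -/
lemma rpow_inv_eq (α : ℝ) (j : ℕ) : (((2 : ℝ) ^ α) ^ j)⁻¹ = dil j * shearBound α j := by
  have h : (2 : ℝ) ^ (2 * j) = (2 : ℝ) ^ ((2 : ℝ) * j) := by
    rw [← Real.rpow_natCast]
    push_cast
    rfl
  rw [dil, shearBound, h, ← Real.rpow_natCast, ← Real.rpow_mul two_pos.le, ← Real.rpow_neg two_pos.le,
    ← Real.rpow_neg two_pos.le, ← Real.rpow_add two_pos]
  congr 1
  ring

lemma dil_eq (j : ℕ) : (((2 : ℝ) ^ 2) ^ j)⁻¹ = dil j := by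
  rw [dil, pow_mul]

lemma warpMat_hor (α : ℝ) (j : ℕ) (l : ℤ) :
    warpMat α .hor j l = !![dil j, -(dil j * l); 0, dil j * shearBound α j] := by
  rw [warpMat, shear_hor_zpow, scalMat, diag_zpow_neg _ _ _ (by positivity) (by positivity),
    rpow_inv_eq, dil_eq]
  simp

lemma warpMat_ver (α : ℝ) (j : ℕ) (l : ℤ) :
    warpMat α .ver j l = !![dil j * shearBound α j, 0; -(dil j * l), dil j] := by
  rw [warpMat, shear_ver_zpow, scalMat, diag_zpow_neg _ _ _ (by positivity) (by positivity),
    rpow_inv_eq, dil_eq]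
  simp

lemma det_warpMat (α : ℝ) (d : Dir) (j : ℕ) (l : ℤ) :
    (warpMat α d j l).det = dil j ^ 2 * shearBound α j := by
  cases d
  · rw [warpMat_hor, Matrix.det_fin_two_of]
    ring
  · rw [warpMat_ver, Matrix.det_fin_two_of]
    ring

lemma warp_eq_rowMap (α : ℝ) (d : Dir) (j : ℕ) (l : ℤ) (ξ : Plane) :
    warp α d j l ξ = rowMap (warpMat α d j l) ξ := rfl

lemma warp_hor (α : ℝ) (j : ℕ) (l : ℤ) (ξ : Plane) :
    warp α .hor j l ξ = ![dil j * ξ 0, dil j * (shearBound α j * ξ 1 - l * ξ 0)] := by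
  rw [warp_eq_rowMap, rowMap, warpMat_hor]
  ext i
  fin_cases i <;> simp [Matrix.vecMul, dotProduct, Fin.sum_univ_two] <;> ring

lemma warp_ver (α : ℝ) (j : ℕ) (l : ℤ) (ξ : Plane) :
    warp α .ver j l ξ = ![dil j * (shearBound α j * ξ 0 - l * ξ 1), dil j * ξ 1] := by
  rw [warp_eq_rowMap, rowMap, warpMat_ver]
  ext i
  fin_cases i <;> simp [Matrix.vecMul, dotProduct, Fin.sum_univ_two] <;> ring

/-- The function `w (N ξₖ / ξᵢ - l)`, extended by `0`. -/
def ratioFun (w : ℝ → ℂ) (N : ℝ) (l : ℝ) (i k : Fin 2) (ξ : Plane) : ℂ :=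
  if ξ i = 0 then 0 else w (N * (ξ k / ξ i) - l)

/-- The cone function depends only on the slope, so the common factor `dil j` cancels. -/
lemma coneFun_warp_hor (v : ℝ → ℂ) (α : ℝ) (j : ℕ) (l : ℤ) (ξ : Plane) :
    coneFun v .hor (warp α .hor j l ξ) = ratioFun v (shearBound α j) l 0 1 ξ := by
  have hd := (dil_pos j).ne'
  by_cases h : ξ 0 = 0
  · simp [coneFun, warp_hor, ratioFun, h]
  · simp only [coneFun, warp_hor, ratioFun, h, Matrix.cons_val_zero, Matrix.cons_val_one,
      mul_eq_zero, hd, or_self, if_false]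
    congr 1
    field_simp

lemma coneFun_warp_ver (v : ℝ → ℂ) (α : ℝ) (j : ℕ) (l : ℤ) (ξ : Plane) :
    coneFun v .ver (warp α .ver j l ξ) = ratioFun v (shearBound α j) l 1 0 ξ := by
  have hd := (dil_pos j).ne'
  by_cases h : ξ 1 = 0
  · simp [coneFun, warp_ver, ratioFun, h]
  · simp only [coneFun, warp_ver, ratioFun, h, Matrix.cons_val_zero, Matrix.cons_val_one,
      mul_eq_zero, hd, or_self, if_false]
    congr 1
    field_simp

/-- For `α_j = m/j` the exponent `(2 - α_j)j = 2j - m` is a natural number. Integrality separates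
the shears below, at and above the bound by unit gaps, matching the support of `v`. -/
lemma IsScalingSequence.exists_shearBound {α : ℕ → ℝ} (hα : IsScalingSequence α) (j : ℕ) :
    ∃ n : ℕ, 1 ≤ n ∧ shearBound (α j) j = n := by
  rcases Nat.eq_zero_or_pos j with rfl | hj
  · exact ⟨1, le_rfl, by simp [shearBound]⟩
  · obtain ⟨m, hm, h⟩ := hα.2 j hj
    obtain ⟨p, hp⟩ := Int.eq_ofNat_of_zero_le (show 0 ≤ 2 * (j : ℤ) - m by omega)
    refine ⟨2 ^ p, Nat.one_le_two_pow, ?_⟩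
    have hj' : (j : ℝ) ≠ 0 := by positivity
    have : (2 - α j) * j = (p : ℝ) := by
      rw [h, sub_mul, div_mul_cancel₀ _ hj']
      exact_mod_cast hp
    rw [shearBound, this, Real.rpow_natCast]
    push_cast
    rfl

end Warp

/-! ### Supports of the cone functions -/

section Ratio

variable {v : ℝ → ℂ}

lemma norm_ratioFun_le (hv : IsBump v) (N l : ℝ) (i k : Fin 2) (ξ : Plane) :
    ‖ratioFun v N l i k ξ‖ ≤ 1 := by
  unfold ratioFun
  split_ifs
  · simp
  · exact hv.norm_le_one _

lemma measurable_ratioFun (hv : IsBump v) (N l : ℝ) (i k : Fin 2) :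
    Measurable (ratioFun v N l i k) := by
  have hi : ∀ i : Fin 2, Measurable fun ξ : Plane => ξ i := fun i => by fun_prop
  have hvm : Measurable v := hv.contDiff.continuous.measurable
  exact Measurable.ite (measurableSet_eq_fun (hi i) measurable_const) measurable_const
    (hvm.comp ((((hi k).div (hi i)).const_mul N).sub_const l))

lemma abs_lt_of_ratioFun_ne_zero (hv : IsBump v) {N l : ℝ} {i k : Fin 2} {ξ : Plane}
    (h : ratioFun v N l i k ξ ≠ 0) : |N * ξ k - l * ξ i| < |ξ i| := by
  unfold ratioFun at h
  split_ifs at h with h0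
  · exact absurd rfl h
  · have h1 : |N * (ξ k / ξ i) - l| < 1 := by
      by_contra h1
      exact h (hv.eq_zero (not_lt.1 h1))
    have h2 : N * ξ k - l * ξ i = (N * (ξ k / ξ i) - l) * ξ i := by field_simp
    rw [h2, abs_mul]
    exact mul_lt_of_lt_one_left (abs_pos.2 h0) h1

/-- Interior functions stay strictly inside their own cone: a nonzero value forces `n|ξ k| < (|l| +
1)|ξ i| ≤ n|ξ i|`. -/
lemma ratioFun_eq_zero_of_le (hv : IsBump v) {n : ℕ} {l : ℤ} (hn : 1 ≤ n) (hl : |(l : ℝ)| < n)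
    {i k : Fin 2} {ξ : Plane} (hξ : |ξ i| ≤ |ξ k|) : ratioFun v n l i k ξ = 0 := by
  by_contra h
  have h1 := abs_lt_of_ratioFun_ne_zero hv h
  have h2 : |(l : ℝ)| + 1 ≤ n := by
    rw [← Int.cast_abs] at hl ⊢
    have : |l| < (n : ℤ) := by exact_mod_cast hl
    exact_mod_cast this
  have h3 : |(n : ℝ) * ξ k| ≤ |n * ξ k - l * ξ i| + |l * ξ i| := by
    have := abs_add_le (n * ξ k - l * ξ i) (l * ξ i)
    simpa using this
  rw [abs_mul, abs_mul, Nat.abs_cast] at h3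
  have h4 : (n : ℝ) * |ξ i| ≤ n * |ξ k| := by gcongr
  nlinarith [abs_nonneg (ξ i)]

/-- Shears beyond the bound miss the cone: a nonzero value forces `n|ξ k| > (|l| - 1)|ξ i| ≥ n|ξ
i|`. -/
lemma ratioFun_eq_zero_of_bound_lt (hv : IsBump v) {n : ℕ} {l : ℤ} (hl : (n : ℝ) < |(l : ℝ)|)
    {i k : Fin 2} {ξ : Plane} (hξ : |ξ k| ≤ |ξ i|) : ratioFun v n l i k ξ = 0 := by
  by_contra h
  have h1 := abs_lt_of_ratioFun_ne_zero hv h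
  have h2 : (n : ℝ) + 1 ≤ |(l : ℝ)| := by
    rw [← Int.cast_abs] at hl ⊢
    have : (n : ℤ) < |l| := by exact_mod_cast hl
    exact_mod_cast this
  have h3 : |l * ξ i| ≤ |n * ξ k - l * ξ i| + |(n : ℝ) * ξ k| := by
    have := abs_add_le (-(n * ξ k - l * ξ i)) (n * ξ k)
    rw [abs_neg] at this
    simpa using this
  rw [abs_mul, abs_mul, Nat.abs_cast] at h3
  have h4 : (n : ℝ) * |ξ k| ≤ n * |ξ i| := by gcongr
  nlinarith [abs_nonneg (ξ i)]

/-- The cone function of the boundary shearlets. -/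
def edgeFun (v : ℝ → ℂ) (N l : ℝ) (ξ : Plane) : ℂ :=
  if |ξ 1| ≤ |ξ 0| then ratioFun v N l 0 1 ξ else ratioFun v N l 1 0 ξ

lemma norm_edgeFun_le (hv : IsBump v) (N l : ℝ) (ξ : Plane) : ‖edgeFun v N l ξ‖ ≤ 1 := by
  unfold edgeFun
  split_ifs <;> exact norm_ratioFun_le hv _ _ _ _ _

lemma measurable_edgeFun (hv : IsBump v) (N l : ℝ) : Measurable (edgeFun v N l) := by
  refine Measurable.ite (measurableSet_le ?_ ?_) (measurable_ratioFun hv _ _ _ _)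
    (measurable_ratioFun hv _ _ _ _) <;> fun_prop

open scoped Classical in
/-- The contributions of all directions to the energy on one level sum up to one. -/
lemma hasSum_level (hv : IsBump v) {n : ℕ} (hn : 1 ≤ n) {ξ : Plane} (hξ : |ξ 0| ≠ |ξ 1|) :
    HasSum (fun l : ℤ =>
      (if |(l : ℝ)| < n then ‖ratioFun v n l 0 1 ξ‖ ^ 2 else 0) +
      ((if |(l : ℝ)| < n then ‖ratioFun v n l 1 0 ξ‖ ^ 2 else 0) +
      (if |(l : ℝ)| = n then ‖edgeFun v n l ξ‖ ^ 2 else 0))) 1 := by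
  -- Inside either cone only its own interior functions and the boundary functions, given there by
  -- that cone's formula, survive. Together they are all the nonzero translates of `v` at one slope.
  rcases lt_or_gt_of_ne hξ with h | h
  · have h1 : ξ 1 ≠ 0 := fun h1 => by simp [h1] at h; exact absurd h (not_lt.2 (abs_nonneg _))
    refine (hv.hasSum_sq (n * (ξ 0 / ξ 1))).congr_fun fun l => ?_
    have h2 : v (n * (ξ 0 / ξ 1) - l) = ratioFun v n l 1 0 ξ := by simp [ratioFun, h1]
    rw [h2]
    rcases lt_trichotomy |(l : ℝ)| n with hl | hl | hl
    · rw [ratioFun_eq_zero_of_le hv hn hl h.le]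
      simp [hl, hl.ne]
    · simp [hl, edgeFun, not_le.2 h]
    · rw [ratioFun_eq_zero_of_bound_lt hv hl h.le]
      simp [not_lt.2 hl.le, hl.ne']
  · have h1 : ξ 0 ≠ 0 := fun h1 => by simp [h1] at h; exact absurd h (not_lt.2 (abs_nonneg _))
    refine (hv.hasSum_sq (n * (ξ 1 / ξ 0))).congr_fun fun l => ?_
    have h2 : v (n * (ξ 1 / ξ 0) - l) = ratioFun v n l 0 1 ξ := by simp [ratioFun, h1]
    rw [h2]
    rcases lt_trichotomy |(l : ℝ)| n with hl | hl | hl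
    · rw [ratioFun_eq_zero_of_le hv hn hl (i := 1) h.le]
      simp [hl, hl.ne]
    · simp [hl, edgeFun, h.le]
    · rw [ratioFun_eq_zero_of_bound_lt hv hl h.le]
      simp [not_lt.2 hl.le, hl.ne']

/-- The two diagonals are proper subspaces, hence null. -/
lemma ae_abs_ne : ∀ᵐ ξ : Plane, |ξ 0| ≠ |ξ 1| := by
  have h : ∀ s : ℝ, s ≠ 0 → ∀ᵐ ξ : Plane, ξ 0 + s * ξ 1 ≠ 0 := by
    intro s hs
    let L : Plane →ₗ[ℝ] ℝ :=
      { toFun := fun ξ => ξ 0 + s * ξ 1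
        map_add' := fun x y => by simp; ring
        map_smul' := fun c x => by simp; ring }
    have hL : L.ker ≠ ⊤ := by
      intro h
      have h1 : EuclideanSpace.single 0 1 ∈ L.ker := h ▸ Submodule.mem_top
      simp [L] at h1
    have := Measure.addHaar_submodule (volume : Measure Plane) _ hL
    exact measure_eq_zero_iff_ae_notMem.1 this
  filter_upwards [h 1 one_ne_zero, h (-1) (by norm_num)] with ξ h1 h2 h3
  rcases abs_eq_abs.1 h3 with h4 | h4
  · exact h2 (by rw [h4]; ring)
  · exact h1 (by rw [h4]; ring)

end Ratio

/-! ### Generators of the system -/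

/-- The generators of the system: the elements up to the lattice parameter `k`. -/
abbrev Gen (α : ℕ → ℝ) : Type :=
  Unit ⊕ Σ j : ℕ, {l : ℤ // |(l : ℝ)| < (2 : ℝ) ^ ((2 - α j) * j)} ⊕
    ({l : ℤ // |(l : ℝ)| < (2 : ℝ) ^ ((2 - α j) * j)} ⊕
      {l : ℤ // |(l : ℝ)| = (2 : ℝ) ^ ((2 - α j) * j)})

/-- An element of the system is a generator together with a lattice parameter. -/
def indexEquiv (α : ℕ → ℝ) : Gen α × (Fin 2 → ℤ) ≃ Index α where
  toFun
    | (.inl _, k) => .coarse k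
    | (.inr ⟨j, .inl l⟩, k) => .interior .hor j l.1 l.2 k
    | (.inr ⟨j, .inr (.inl l)⟩, k) => .interior .ver j l.1 l.2 k
    | (.inr ⟨j, .inr (.inr l)⟩, k) => .boundary j l.1 l.2 k
  invFun
    | .coarse k => (.inl (), k)
    | .interior .hor j l hl k => (.inr ⟨j, .inl ⟨l, hl⟩⟩, k)
    | .interior .ver j l hl k => (.inr ⟨j, .inr (.inl ⟨l, hl⟩)⟩, k)
    | .boundary j l hl k => (.inr ⟨j, .inr (.inr ⟨l, hl⟩)⟩, k)
  left_inv := by rintro ⟨_ | ⟨j, l | l | l⟩, k⟩ <;> rfl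
  right_inv := by rintro (k | ⟨_ | _, j, l, hl, k⟩ | ⟨j, l, hl, k⟩) <;> rfl

variable {φ : 𝓢(ℝ, ℂ)} {v : ℝ → ℂ} {α : ℕ → ℝ}

/-- The modulus-carrying factor of the Fourier transform of a generator. -/
def profile (φ : 𝓢(ℝ, ℂ)) (v : ℝ → ℂ) (α : ℕ → ℝ) : Gen α → Plane → ℂ
  | .inl _, ξ => scalHat φ ξ
  | .inr ⟨j, .inl l⟩, ξ => corona φ (dil j • ξ) * ratioFun v (shearBound (α j) j) l.1 0 1 ξ
  | .inr ⟨j, .inr (.inl l)⟩, ξ => corona φ (dil j • ξ) * ratioFun v (shearBound (α j) j) l.1 1 0 ξ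
  | .inr ⟨j, .inr (.inr l)⟩, ξ => corona φ (dil j • ξ) * edgeFun v (shearBound (α j) j) l.1 ξ

/-- The normalizing factor of a generator. -/
def amp (α : ℕ → ℝ) : Gen α → ℝ
  | .inl _ => 1
  | .inr ⟨j, .inl _⟩ => (2 : ℝ) ^ (-((2 + α j) * j / 2))
  | .inr ⟨j, .inr (.inl _)⟩ => (2 : ℝ) ^ (-((2 + α j) * j / 2))
  | .inr ⟨j, .inr (.inr _)⟩ => if j = 0 then 1 else (2 : ℝ) ^ (-((2 + α j) * j / 2) - 1)

/-- The matrix of the modulations of a generator. -/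
def genMat (α : ℕ → ℝ) : Gen α → Matrix (Fin 2) (Fin 2) ℝ
  | .inl _ => 1
  | .inr ⟨j, .inl l⟩ => warpMat (α j) .hor j l.1
  | .inr ⟨j, .inr (.inl l)⟩ => warpMat (α j) .ver j l.1
  | .inr ⟨j, .inr (.inr l)⟩ => if j = 0 then 1 else (1 / 2 : ℝ) • warpMat (α j) .hor j l.1

/-- The Fourier transform of an element of the system. -/
def genHat (φ : 𝓢(ℝ, ℂ)) (v : ℝ → ℂ) (α : ℕ → ℝ) (p : Gen α × (Fin 2 → ℤ)) (ξ : Plane) : ℂ :=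
  amp α p.1 * profile φ v α p.1 ξ * phase 1 (rowMap (genMat α p.1) ξ) p.2

lemma rowMap_one (ξ : Plane) : rowMap 1 ξ = ξ.ofLp := by
  simp [rowMap]

lemma rowMap_smul (s : ℝ) (M : Matrix (Fin 2) (Fin 2) ℝ) (ξ : Plane) :
    rowMap (s • M) ξ = s • rowMap M ξ := by
  simp [rowMap, Matrix.vecMul_smul]

lemma dil_zero : dil 0 = 1 := by simp [dil]

/-- Translation is modulation on the Fourier side; this gives the coarse functions the shape of the
other generators, with matrix 1. -/
lemma fourierInv_sub_apply (g : Plane → ℂ) (k : Fin 2 → ℤ) (x : Plane) :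
    𝓕⁻ g (x - WithLp.toLp 2 fun i => (k i : ℝ))
      = 𝓕⁻ (fun ξ => g ξ * phase 1 (rowMap 1 ξ) k) x := by
  simp only [Real.fourierInv_eq', rowMap_one]
  refine integral_congr_ae ?_
  filter_upwards with ξ
  rw [smul_eq_mul, smul_eq_mul, mul_comm (g ξ), ← mul_assoc, phase, ← Complex.exp_add]
  congr 2
  rw [inner_sub_right]
  have : inner ℝ ξ (WithLp.toLp 2 fun i => (k i : ℝ)) = ξ.ofLp ⬝ᵥ fun i => (k i : ℝ) := by
    simp [PiLp.inner_apply, dotProduct, mul_comm]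
  rw [this]
  push_cast
  ring

theorem unish_indexEquiv (p : Gen α × (Fin 2 → ℤ)) :
    unish φ v α (indexEquiv α p) = 𝓕⁻ (genHat φ v α p) := by
  rcases p with ⟨_ | ⟨j, l | l | l⟩, k⟩
  · ext x
    simp only [indexEquiv, Equiv.coe_fn_mk, unish, fourierInv_sub_apply]
    refine congrFun (congrArg 𝓕⁻ (funext fun ξ => ?_)) x
    simp [genHat, amp, profile, genMat]
  · simp only [indexEquiv, Equiv.coe_fn_mk, unish]
    congr 1
    ext ξ
    simp only [interiorHat, coneFun_warp_hor]
    simp only [genHat, amp, profile, genMat, warp_eq_rowMap, dil]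
    ring
  · simp only [indexEquiv, Equiv.coe_fn_mk, unish]
    congr 1
    ext ξ
    simp only [interiorHat, coneFun_warp_ver]
    simp only [genHat, amp, profile, genMat, warp_eq_rowMap, dil]
    ring
  · simp only [indexEquiv, Equiv.coe_fn_mk, unish]
    congr 1
    ext ξ
    simp only [boundaryHat, coneFun_warp_hor, coneFun_warp_ver, genHat, amp, profile, genMat]
    by_cases hj : j = 0
    · subst hj
      simp [rowMap_one, dil_zero, edgeFun]
    · simp only [hj, if_false, rowMap_smul, phase_smul, warp_eq_rowMap, dil, edgeFun]
      ring

/-! ### Supports and sizes of the generators -/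

lemma det_genMat_ne_zero (g : Gen α) : (genMat α g).det ≠ 0 := by
  have h : ∀ (a : ℝ) (d : Dir) (j : ℕ) (l : ℤ), (warpMat a d j l).det ≠ 0 := fun a d j l => by
    rw [det_warpMat]
    exact mul_ne_zero (pow_ne_zero _ (dil_pos j).ne') (shearBound_pos a j).ne'
  rcases g with _ | ⟨j, l | l | l⟩
  · simp [genMat]
  · exact h _ _ _ _
  · exact h _ _ _ _
  · simp only [genMat]
    split_ifs
    · simp
    · rw [Matrix.det_smul]
      exact mul_ne_zero (by norm_num) (h _ _ _ _)

/-- Both sides are `2^(-(2+α_j)j)` for interior shearlets. For boundary shearlets with `j ≥ 1`, the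
extra amplitude 1/2 squares to the determinant 1/4 of the halved matrix. -/
lemma amp_sq (g : Gen α) : amp α g ^ 2 = |(genMat α g).det| := by
  have h : ∀ (a : ℝ) (d : Dir) (j : ℕ) (l : ℤ),
      ((2 : ℝ) ^ (-((2 + a) * j / 2))) ^ 2 = |(warpMat a d j l).det| := fun a d j l => by
    have h1 := dil_pos j
    have h2 := shearBound_pos a j
    rw [det_warpMat, abs_of_pos (by positivity), pow_two (dil j), mul_assoc, ← rpow_inv_eq, dil,
      ← Real.rpow_natCast, ← Real.rpow_natCast, ← Real.rpow_natCast, ← Real.rpow_mul two_pos.le,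
      ← Real.rpow_mul two_pos.le, ← Real.rpow_neg two_pos.le, ← Real.rpow_neg two_pos.le,
      ← Real.rpow_add two_pos]
    congr 1
    push_cast
    ring
  rcases g with _ | ⟨j, l | l | l⟩
  · simp [genMat, amp]
  · exact h _ _ _ _
  · exact h _ _ _ _
  · simp only [genMat, amp]
    split_ifs
    · simp
    · rw [Matrix.det_smul, abs_mul, ← h, Real.rpow_sub_one two_ne_zero, div_pow]
      norm_num
      ring

lemma norm_profile_le (hφ : IsMeyerScaling φ) (hv : IsBump v) (g : Gen α) (ξ : Plane) :
    ‖profile φ v α g ξ‖ ≤ 1 := by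
  have h : ∀ (j : ℕ) (z : ℂ), ‖z‖ ≤ 1 → ‖(corona φ (dil j • ξ) : ℂ) * z‖ ≤ 1 := fun j z hz => by
    rw [norm_mul, Complex.norm_real, Real.norm_of_nonneg (corona_nonneg _)]
    exact mul_le_one₀ (corona_le_one hφ _) (norm_nonneg _) hz
  rcases g with _ | ⟨j, l | l | l⟩
  · simp only [profile]
    rw [Complex.norm_real, Real.norm_of_nonneg (scalHat_nonneg hφ _)]
    exact scalHat_le_one hφ _
  · exact h _ _ (norm_ratioFun_le hv _ _ _ _ _)
  · exact h _ _ (norm_ratioFun_le hv _ _ _ _ _)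
  · exact h _ _ (norm_edgeFun_le hv _ _ _)

lemma measurable_profile (hv : IsBump v) (g : Gen α) : Measurable (profile φ v α g) := by
  have h : ∀ j : ℕ, Measurable fun ξ : Plane => (corona φ (dil j • ξ) : ℂ) := fun j => by
    have : Continuous fun ξ : Plane => corona φ (dil j • ξ) :=
      continuous_corona.comp (by fun_prop)
    exact (Complex.continuous_ofReal.comp this).measurable
  rcases g with _ | ⟨j, l | l | l⟩
  · exact (Complex.continuous_ofReal.comp contDiff_scalHat.continuous).measurable
  · exact (h j).mul (measurable_ratioFun hv _ _ _ _)
  · exact (h j).mul (measurable_ratioFun hv _ _ _ _)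
  · exact (h j).mul (measurable_edgeFun hv _ _)

lemma abs_le_of_corona_dil_ne_zero (hφ : IsMeyerScaling φ) {j : ℕ} {ξ : Plane}
    (h : corona φ (dil j • ξ) ≠ 0) (i : Fin 2) : dil j * |ξ i| ≤ 1 / 2 := by
  have := abs_le_of_corona_ne_zero hφ h i
  simpa [abs_mul, abs_of_pos (dil_pos j)] using this

/-- For a shearlet, the corona bounds `dil j * |ξ i|` by 1/2, and the cone function bounds the
sheared coordinate by the same quantity. -/
lemma abs_rowMap_le_of_profile_ne_zero (hφ : IsMeyerScaling φ) (hv : IsBump v) {g : Gen α}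
    {ξ : Plane} (h : profile φ v α g ξ ≠ 0) (i : Fin 2) : |rowMap (genMat α g) ξ i| ≤ 1 / 2 := by
  have key : ∀ {a : ℝ} {j : ℕ} {l : ℝ} {i k : Fin 2},
      ratioFun v (shearBound a j) l i k ξ ≠ 0 → dil j * |ξ i| ≤ 1 / 2 →
        |dil j * (shearBound a j * ξ k - l * ξ i)| ≤ 1 / 2 := by
    intro a j l i k h1 h2
    rw [abs_mul, abs_of_pos (dil_pos j)]
    have := mul_lt_mul_of_pos_left (abs_lt_of_ratioFun_ne_zero hv h1) (dil_pos j)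
    linarith
  have dab : ∀ (j : ℕ) (x : ℝ), |dil j * x| = dil j * |x| := fun j x => by
    rw [abs_mul, abs_of_pos (dil_pos j)]
  rcases g with _ | ⟨j, l | l | l⟩
  · simp only [genMat, rowMap_one]
    simp only [profile, ne_eq, Complex.ofReal_eq_zero] at h
    have := abs_le_of_scalHat_ne_zero hφ h i
    linarith
  · simp only [profile, ne_eq, mul_eq_zero, not_or, Complex.ofReal_eq_zero] at h
    have hc := abs_le_of_corona_dil_ne_zero hφ h.1
    simp only [genMat, ← warp_eq_rowMap, warp_hor]
    fin_cases i
    · simpa [dab] using hc 0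
    · simpa using key h.2 (hc 0)
  · simp only [profile, ne_eq, mul_eq_zero, not_or, Complex.ofReal_eq_zero] at h
    have hc := abs_le_of_corona_dil_ne_zero hφ h.1
    simp only [genMat, ← warp_eq_rowMap, warp_ver]
    fin_cases i
    · simpa using key h.2 (hc 1)
    · simpa [dab] using hc 1
  · simp only [profile, ne_eq, mul_eq_zero, not_or, Complex.ofReal_eq_zero] at h
    have hc := abs_le_of_corona_dil_ne_zero hφ h.1
    simp only [genMat]
    split_ifs with hj
    · subst hj
      simpa [rowMap_one, dil_zero] using hc i
    · rw [rowMap_smul, ← warp_eq_rowMap, warp_hor]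
      -- For `l = ±N` the horizontal and vertical sheared coordinates agree up to sign, so the
      -- horizontal modulation also suits the vertical cone.
      have hswap : |shearBound (α j) j * ξ 1 - l.1 * ξ 0| = |shearBound (α j) j * ξ 0 - l.1 * ξ 1| := by
        have hl : |(l.1 : ℝ)| = shearBound (α j) j := l.2
        rcases abs_choice (l.1 : ℝ) with h0 | h0 <;> rw [h0] at hl <;> rw [← hl]
        · rw [← abs_neg]
          ring_nf
        · ring_nf
      have h2 : |dil j * (shearBound (α j) j * ξ 1 - l.1 * ξ 0)| ≤ 1 / 2 := by
        have h2 := h.2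
        unfold edgeFun at h2
        split_ifs at h2
        · exact key h2 (hc 0)
        · rw [dab, hswap, ← dab]
          exact key h2 (hc 1)
      have hhalf : ∀ x : ℝ, |x| ≤ 1 / 2 → |(1 / 2 : ℝ) * x| ≤ 1 / 2 := fun x hx => by
        rw [abs_mul, abs_of_pos (by norm_num : (0 : ℝ) < 1 / 2)]
        linarith [abs_nonneg x]
      fin_cases i
      · exact hhalf _ (by simpa [dab] using hc 0)
      · exact hhalf _ h2

lemma exists_bound_of_profile_ne_zero (hφ : IsMeyerScaling φ) (g : Gen α) :
    ∃ R : ℝ, ∀ ξ, profile φ v α g ξ ≠ 0 → ∀ i, |ξ i| ≤ R := by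
  have key : ∀ (j : ℕ) (z : Plane → ℂ) (ξ : Plane), (corona φ (dil j • ξ) : ℂ) * z ξ ≠ 0 →
      ∀ i, |ξ i| ≤ 1 / 2 / dil j := by
    intro j z ξ h i
    simp only [ne_eq, mul_eq_zero, not_or, Complex.ofReal_eq_zero] at h
    rw [le_div_iff₀ (dil_pos j), mul_comm]
    exact abs_le_of_corona_dil_ne_zero hφ h.1 i
  rcases g with _ | ⟨j, l | l | l⟩
  · refine ⟨1 / 8, fun ξ h => abs_le_of_scalHat_ne_zero hφ ?_⟩
    simpa [profile] using h
  · exact ⟨_, fun ξ h => key j _ ξ h⟩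
  · exact ⟨_, fun ξ h => key j _ ξ h⟩
  · exact ⟨_, fun ξ h => key j _ ξ h⟩

lemma isCompact_box (R : ℝ) : IsCompact {ξ : Plane | ∀ i, |ξ i| ≤ R} := by
  have h : {ξ : Plane | ∀ i, |ξ i| ≤ R}
      = WithLp.toLp 2 '' Set.Icc (fun _ => -R : Fin 2 → ℝ) (fun _ => R) := by
    ext ξ
    constructor
    · intro h
      exact ⟨ξ.ofLp, ⟨fun i => (abs_le.1 (h i)).1, fun i => (abs_le.1 (h i)).2⟩, rfl⟩
    · rintro ⟨x, hx, rfl⟩ i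
      exact abs_le.2 ⟨hx.1 i, hx.2 i⟩
  rw [h]
  exact isCompact_Icc.image (PiLp.continuous_toLp 2 _)

lemma hasCompactSupport_genHat (hφ : IsMeyerScaling φ) (p : Gen α × (Fin 2 → ℤ)) :
    HasCompactSupport (genHat φ v α p) := by
  obtain ⟨R, hR⟩ := exists_bound_of_profile_ne_zero (v := v) hφ p.1
  refine HasCompactSupport.intro (isCompact_box R) fun ξ hξ => ?_
  have : profile φ v α p.1 ξ = 0 := by
    by_contra h
    exact hξ (hR ξ h)
  simp [genHat, this]

lemma contDiff_phase (M : Matrix (Fin 2) (Fin 2) ℝ) (k : Fin 2 → ℤ) :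
    ContDiff ℝ ∞ fun ξ : Plane => phase 1 (rowMap M ξ) k := by
  have h : ContDiff ℝ ∞ fun ξ : Plane => 2 * Real.pi * 1 * (rowMap M ξ ⬝ᵥ fun i => (k i : ℝ)) := by
    simp only [rowMap, Matrix.vecMul, dotProduct, Fin.sum_univ_two]
    fun_prop
  have h1 : ContDiff ℝ ∞ fun ξ : Plane =>
      ((2 * Real.pi * 1 * (rowMap M ξ ⬝ᵥ fun i => (k i : ℝ)) : ℝ) : ℂ) :=
    Complex.ofRealCLM.contDiff.comp h
  exact (h1.neg.mul contDiff_const).cexp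

lemma memLp_genHat (hφ : IsMeyerScaling φ) (hv : IsBump v) (p : Gen α × (Fin 2 → ℤ)) (q : ENNReal) :
    MemLp (genHat φ v α p) q volume := by
  have hm : Measurable (genHat φ v α p) :=
    ((measurable_profile hv p.1).const_mul _).mul (contDiff_phase _ _).continuous.measurable
  have hb : ∀ ξ, ‖genHat φ v α p ξ‖ ≤ |amp α p.1| := fun ξ => by
    rw [genHat, norm_mul, norm_mul, norm_phase, mul_one, Complex.norm_real, Real.norm_eq_abs]
    exact mul_le_of_le_one_right (abs_nonneg _) (norm_profile_le hφ hv _ _)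
  have hK := hasCompactSupport_genHat (v := v) hφ p
  have hind : (tsupport (genHat φ v α p)).indicator (genHat φ v α p) = genHat φ v α p :=
    Set.indicator_eq_self.2 (subset_tsupport _)
  rw [← hind, memLp_indicator_iff_restrict hK.isCompact.measurableSet]
  have : IsFiniteMeasure (volume.restrict (tsupport (genHat φ v α p))) :=
    ⟨by simpa using hK.isCompact.measure_lt_top⟩
  exact MemLp.of_bound hm.aestronglyMeasurable _ (Filter.Eventually.of_forall hb)

lemma integrable_genHat (hφ : IsMeyerScaling φ) (hv : IsBump v) (p : Gen α × (Fin 2 → ℤ)) :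
    Integrable (genHat φ v α p) :=
  memLp_one_iff_integrable.1 (memLp_genHat hφ hv p 1)

/-! ### The Parseval frame property -/

lemma tsum_gen (f : Gen α → ENNReal) :
    ∑' g, f g = f (.inl ()) + ∑' j, (∑' l, f (.inr ⟨j, .inl l⟩) +
      (∑' l, f (.inr ⟨j, .inr (.inl l)⟩) + ∑' l, f (.inr ⟨j, .inr (.inr l)⟩))) := by
  rw [ENNReal.summable.tsum_sum ENNReal.summable]
  congr 1
  · simp
  · rw [ENNReal.summable.tsum_sigma' fun _ => ENNReal.summable]
    refine tsum_congr fun j => ?_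
    rw [ENNReal.summable.tsum_sum ENNReal.summable,
      ENNReal.summable.tsum_sum ENNReal.summable]

/-- Each level contributes its squared corona function by `hasSum_level`, and the levels telescope.
Sums in `ENNReal` can be regrouped without summability conditions. -/
lemma tsum_norm_profile_sq (hφ : IsMeyerScaling φ) (hv : IsBump v) (hα : IsScalingSequence α)
    {ξ : Plane} (hξ : |ξ 0| ≠ |ξ 1|) :
    ∑' g, ENNReal.ofReal (‖profile φ v α g ξ‖ ^ 2) = 1 := by
  classical
  have hlev : ∀ j : ℕ, ∑' l, ENNReal.ofReal (‖profile φ v α (.inr ⟨j, .inl l⟩) ξ‖ ^ 2) +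
      (∑' l, ENNReal.ofReal (‖profile φ v α (.inr ⟨j, .inr (.inl l)⟩) ξ‖ ^ 2) +
        ∑' l, ENNReal.ofReal (‖profile φ v α (.inr ⟨j, .inr (.inr l)⟩) ξ‖ ^ 2))
      = ENNReal.ofReal (corona φ (dil j • ξ) ^ 2) := by
    intro j
    obtain ⟨n, hn, hN⟩ := hα.exists_shearBound j
    have hN' : (2 : ℝ) ^ ((2 - α j) * j) = n := hN
    have hw : ∀ z : ℂ, ENNReal.ofReal (‖(corona φ (dil j • ξ) : ℂ) * z‖ ^ 2)
        = ENNReal.ofReal (corona φ (dil j • ξ) ^ 2) * ENNReal.ofReal (‖z‖ ^ 2) := fun z => by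
      rw [norm_mul, mul_pow, ENNReal.ofReal_mul (by positivity), Complex.norm_real,
        Real.norm_eq_abs, sq_abs]
    simp only [profile, hw, ENNReal.tsum_mul_left, ← mul_add, hN]
    have hs : ∀ (P : ℤ → Prop) [DecidablePred P] (F : ℤ → ℝ),
        ∑' l : {l : ℤ // P l}, ENNReal.ofReal (F l.1)
          = ∑' l : ℤ, ENNReal.ofReal (if P l then F l else 0) := by
      intro P _ F
      rw [show (∑' l : {l : ℤ // P l}, ENNReal.ofReal (F l.1)) = _ from
        tsum_subtype {l : ℤ | P l} fun l => ENNReal.ofReal (F l)]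
      refine tsum_congr fun l => ?_
      by_cases h : P l <;> simp [h]
    rw [hs _ (fun l => ‖ratioFun v n l 0 1 ξ‖ ^ 2), hs _ (fun l => ‖ratioFun v n l 1 0 ξ‖ ^ 2),
      hs _ (fun l => ‖edgeFun v n l ξ‖ ^ 2), ← ENNReal.tsum_add, ← ENNReal.tsum_add]
    have hL := hasSum_level hv hn hξ
    have hnn : ∀ (P : Prop) [Decidable P] (z : ℂ), 0 ≤ (if P then ‖z‖ ^ 2 else 0) := by
      intro P _ z
      split_ifs <;> positivity
    have h1 := ENNReal.ofReal_tsum_of_nonneg (fun l => add_nonneg (hnn _ _)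
      (add_nonneg (hnn _ _) (hnn _ _))) hL.summable
    rw [hL.tsum_eq, ENNReal.ofReal_one] at h1
    refine Eq.trans ?_ (mul_one _)
    rw [h1]
    congr 1
    simp only [hN']
    refine tsum_congr fun l => ?_
    rw [ENNReal.ofReal_add (hnn _ _) (add_nonneg (hnn _ _) (hnn _ _)),
      ENNReal.ofReal_add (hnn _ _) (hnn _ _)]
  rw [tsum_gen]
  simp only [hlev]
  have hc := hasSum_corona_sq hφ ξ
  have h1 := ENNReal.ofReal_tsum_of_nonneg (fun j => sq_nonneg _) hc.summable
  rw [hc.tsum_eq] at h1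
  simp only [dil, ← h1, profile]
  rw [← ENNReal.ofReal_add (by positivity)
    (sub_nonneg.2 (pow_le_one₀ (scalHat_nonneg hφ _) (scalHat_le_one hφ _))),
    Complex.norm_real, Real.norm_eq_abs, sq_abs]
  simp

lemma norm_sq_eq_integral (f : Lp ℂ 2 (volume : Measure Plane)) :
    ‖f‖ ^ 2 = ∫ ξ, ‖f ξ‖ ^ 2 := by
  have h := inner_self_eq_norm_sq_to_K (𝕜 := ℂ) f
  rw [L2.inner_def] at h
  have h2 : ∀ ξ, inner ℂ (f ξ) (f ξ) = ((‖f ξ‖ ^ 2 : ℝ) : ℂ) := fun ξ => by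
    rw [inner_self_eq_norm_sq_to_K]
    simp
  simp only [h2] at h
  rw [integral_complex_ofReal] at h
  have h3 : ((‖f‖ ^ 2 : ℝ) : ℂ) = ((∫ ξ, ‖f ξ‖ ^ 2 : ℝ) : ℂ) := by
    rw [h]
    simp
  exact_mod_cast h3

/-- Sum over the lattice first, by Parseval for one generator, then over the generators under the
integral by Tonelli. -/
theorem isParsevalFrame_genHat (hφ : IsMeyerScaling φ) (hv : IsBump v) (hα : IsScalingSequence α)
    (F : Lp ℂ 2 (volume : Measure Plane)) :
    HasSum (fun p : Gen α × (Fin 2 → ℤ) =>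
      ‖∫ ξ, (starRingEnd ℂ) (genHat φ v α p ξ) * F ξ‖ ^ 2) (‖F‖ ^ 2) := by
  have hF := Lp.memLp F
  have hFi : Integrable (fun ξ => ‖F ξ‖ ^ 2) := hF.integrable_norm_pow two_ne_zero
  have hgen : ∀ g : Gen α, ∑' k : Fin 2 → ℤ,
      ENNReal.ofReal (‖∫ ξ, (starRingEnd ℂ) (genHat φ v α (g, k) ξ) * F ξ‖ ^ 2)
        = ∫⁻ ξ, ENNReal.ofReal (‖profile φ v α g ξ‖ ^ 2) * ENNReal.ofReal (‖F ξ‖ ^ 2) := by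
    intro g
    have h := hasSum_sq_integral_generator (det_genMat_ne_zero g) (amp_sq g)
      (measurable_profile (φ := φ) hv g).aestronglyMeasurable (norm_profile_le hφ hv g)
      (fun ξ => abs_rowMap_le_of_profile_ne_zero hφ hv) hF
    have h1 := ENNReal.ofReal_tsum_of_nonneg (fun _ => sq_nonneg _) h.summable
    rw [h.tsum_eq] at h1
    refine h1.symm.trans ?_
    rw [ofReal_integral_eq_lintegral_ofReal]
    · simp only [ENNReal.ofReal_mul (sq_nonneg _)]
    · refine hFi.bdd_mul (c := 1)
        ((measurable_profile hv g).norm.pow_const 2).aestronglyMeasurable ?_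
      filter_upwards with ξ
      rw [norm_pow, norm_norm]
      exact pow_le_one₀ (norm_nonneg _) (norm_profile_le hφ hv g ξ)
    · filter_upwards with ξ
      positivity
  have htot : ∑' p : Gen α × (Fin 2 → ℤ),
      ENNReal.ofReal (‖∫ ξ, (starRingEnd ℂ) (genHat φ v α p ξ) * F ξ‖ ^ 2)
        = ENNReal.ofReal (‖F‖ ^ 2) := by
    rw [ENNReal.summable.tsum_prod' fun _ => ENNReal.summable]
    simp only [hgen]
    rw [← lintegral_tsum, norm_sq_eq_integral, ofReal_integral_eq_lintegral_ofReal hFi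
      (by filter_upwards with ξ; positivity)]
    · refine lintegral_congr_ae ?_
      filter_upwards [ae_abs_ne] with ξ hξ
      rw [ENNReal.tsum_mul_right, tsum_norm_profile_sq hφ hv hα hξ, one_mul]
    · intro g
      exact (((measurable_profile hv g).norm.pow_const 2).ennreal_ofReal.aemeasurable).mul
        ((hF.1.norm.aemeasurable.pow_const 2).ennreal_ofReal)
  -- Finiteness of the extended total brings the identity back to real sums.
  have hsum : Summable fun p : Gen α × (Fin 2 → ℤ) =>
      ‖∫ ξ, (starRingEnd ℂ) (genHat φ v α p ξ) * F ξ‖ ^ 2 := by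
    have := ENNReal.summable_toReal (htot.trans_ne ENNReal.ofReal_ne_top)
    simpa only [ENNReal.toReal_ofReal (sq_nonneg _)] using this
  convert hsum.hasSum using 1
  rw [← ENNReal.ofReal_tsum_of_nonneg (fun _ => sq_nonneg _) hsum] at htot
  exact ((ENNReal.ofReal_eq_ofReal_iff (tsum_nonneg fun _ => sq_nonneg _) (sq_nonneg _)).1 htot).symm

/-! ### Smoothness of the generators -/

section Smooth

variable {v : ℝ → ℂ}

lemma continuous_coord (i : Fin 2) : Continuous fun ξ : Plane => ξ i := by fun_prop

lemma contDiffAt_comp_ratio {w : ℝ → ℂ} (hw : ContDiff ℝ ∞ w) (N l : ℝ) {i : Fin 2} (k : Fin 2)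
    {ξ : Plane} (h : ξ i ≠ 0) : ContDiffAt ℝ ∞ (fun y : Plane => w (N * (y k / y i) - l)) ξ := by
  have hc : ∀ i : Fin 2, ContDiffAt ℝ ∞ (fun y : Plane => y i) ξ := fun i => by fun_prop
  exact hw.contDiffAt.comp ξ ((contDiffAt_const.mul ((hc k).div (hc i) h)).sub contDiffAt_const)

lemma contDiffAt_ratioFun_of_ne {w : ℝ → ℂ} (hw : ContDiff ℝ ∞ w) (N l : ℝ) {i : Fin 2}
    (k : Fin 2) {ξ : Plane} (h : ξ i ≠ 0) : ContDiffAt ℝ ∞ (ratioFun w N l i k) ξ := by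
  refine (contDiffAt_comp_ratio hw N l k h).congr_of_eventuallyEq ?_
  filter_upwards [(continuous_coord i).continuousAt.eventually_ne h] with y hy
  exact if_neg hy

lemma contDiffAt_ratioFun (hv : IsBump v) {N : ℝ} (hN : 0 < N) (l : ℝ) {i k : Fin 2} {ξ : Plane}
    (h : ξ i ≠ 0 ∨ ξ k ≠ 0) : ContDiffAt ℝ ∞ (ratioFun v N l i k) ξ := by
  by_cases hi : ξ i = 0
  · have hk : ξ k ≠ 0 := by tauto
    -- Near the line `ξ i = 0` the slope is so large that `v` is evaluated outside its support.
    have hlt : ∀ᶠ y : Plane in nhds ξ, (1 + |l|) * |y i| < N * |y k| := by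
      refine ContinuousAt.eventually_lt (by fun_prop) (by fun_prop) ?_
      rw [hi, abs_zero, mul_zero]
      exact mul_pos hN (abs_pos.2 hk)
    refine (contDiffAt_const (c := (0 : ℂ))).congr_of_eventuallyEq ?_
    filter_upwards [hlt] with y hy
    by_contra hne
    have h1 := abs_lt_of_ratioFun_ne_zero hv hne
    have h2 : |N * y k| ≤ |N * y k - l * y i| + |l * y i| := by
      have := abs_add_le (N * y k - l * y i) (l * y i)
      simpa using this
    rw [abs_mul, abs_mul, abs_of_pos hN] at h2
    linarith
  · exact contDiffAt_ratioFun_of_ne hv.contDiff N l k hi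

/-- Flatness at 0 with `v 0 = 1` allows one half of `v` to be replaced by the constant 1; `ε`
selects which half. -/
lemma exists_oneSided (hv : IsBump v) {ε : ℝ} (hε : ε = 1 ∨ ε = -1) :
    ∃ w : ℝ → ℂ, ContDiff ℝ ∞ w ∧ (∀ u, ε * u ≤ 0 → w u = v u) ∧ ∀ u, 0 ≤ ε * u → w u = 1 := by
  rcases hε with rfl | rfl
  · refine ⟨_, contDiff_ite_le_of_iteratedDeriv hv.contDiff hv.iteratedDeriv_zero, ?_, ?_⟩
    · intro u hu
      exact if_pos (by linarith)
    · intro u hu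
      rw [one_mul] at hu
      rcases hu.eq_or_lt with rfl | h
      · simp [hv.map_zero]
      · simp [not_le.2 h, hv.map_zero]
  · refine ⟨_, contDiff_ite_ge_of_iteratedDeriv hv.contDiff hv.iteratedDeriv_zero, ?_, ?_⟩
    · intro u hu
      exact if_pos (by linarith)
    · intro u hu
      have hu' : u ≤ 0 := by linarith
      rcases hu'.eq_or_lt with rfl | h
      · simp [hv.map_zero]
      · simp [not_le.2 h, hv.map_zero]

/-- Off the diagonals a single formula holds locally. On the diagonal of slope `-ε` both formulas
vanish nearby; on that of slope `ε` both arguments of `v` are 0, where flatness glues them. -/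
lemma contDiffAt_edgeFun (hv : IsBump v) {N ε : ℝ} (hN : 1 ≤ N) (hε : ε = 1 ∨ ε = -1) {ξ : Plane}
    (h : ξ 0 ≠ 0 ∨ ξ 1 ≠ 0) : ContDiffAt ℝ ∞ (edgeFun v N (ε * N)) ξ := by
  have hN0 : 0 < N := by linarith
  have hε2 : ε * ε = 1 := by rcases hε with rfl | rfl <;> norm_num
  have hca : ∀ i : Fin 2, Continuous fun y : Plane => |y i| := fun i => (continuous_coord i).abs
  rcases lt_trichotomy |ξ 0| |ξ 1| with hlt | heq | hlt
  · refine (contDiffAt_ratioFun hv hN0 (ε * N) (i := 1) (k := 0)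
      h.symm).congr_of_eventuallyEq ?_
    filter_upwards [(hca 0).continuousAt.eventually_lt (hca 1).continuousAt hlt] with y hy
    exact if_neg (not_le.2 hy)
  · have h0 : ξ 0 ≠ 0 ∧ ξ 1 ≠ 0 := by
      rw [← abs_pos, ← abs_pos] at h ⊢
      rw [heq] at h ⊢
      tauto
    have hquot : ContinuousAt (fun y : Plane => ε * (y 1 / y 0)) ξ :=
      continuousAt_const.mul ((continuous_coord 1).continuousAt.div
        (continuous_coord 0).continuousAt h0.1)
    have hne : ∀ᶠ y : Plane in nhds ξ, y 0 ≠ 0 ∧ y 1 ≠ 0 :=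
      ((continuous_coord 0).continuousAt.eventually_ne h0.1).and
        ((continuous_coord 1).continuousAt.eventually_ne h0.2)
    have hprod : ε * (ξ 1 / ξ 0) ≠ 0 :=
      mul_ne_zero (left_ne_zero_of_mul_eq_one hε2) (div_ne_zero h0.2 h0.1)
    rcases lt_or_gt_of_ne hprod with hs | hs
    · refine (contDiffAt_const (c := (0 : ℂ))).congr_of_eventuallyEq ?_
      filter_upwards [hquot.eventually_lt_const hs, hne] with y hy hyn
      have key : ∀ t : ℝ, ε * t < 0 → v (N * t - ε * N) = 0 := by
        intro t ht
        refine hv.eq_zero ?_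
        -- The left-hand side of the identity below is `N` plus a positive term, so the argument of
        -- `v` has modulus at least `N ≥ 1`.
        have h1 : 1 ≤ -(ε * (N * t - ε * N)) := by
          have : -(ε * (N * t - ε * N)) = (ε * ε) * N + N * -(ε * t) := by ring
          rw [this, hε2]
          nlinarith
        rcases hε with rfl | rfl
        · rw [one_mul] at h1
          exact h1.trans (neg_le_abs _)
        · exact h1.trans (by rw [neg_mul, neg_neg, one_mul]; exact le_abs_self _)
      have hy' : ε * (y 0 / y 1) < 0 := by
        have : ε * (y 0 / y 1) = (ε * ε) / (ε * (y 1 / y 0)) := by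
          have := left_ne_zero_of_mul_eq_one hε2
          have h1 := hyn.1
          have h2 := hyn.2
          field_simp
        rw [this, hε2]
        exact one_div_neg.2 hy
      simp only [edgeFun, ratioFun, hyn.1, hyn.2, key _ hy, key _ hy', ite_self]
    · obtain ⟨w, hw, hwv, hw1⟩ := exists_oneSided hv hε
      -- The glued function is a product of the two one-sided versions: on each side of the diagonal
      -- one factor is 1 and the other is the formula valid there.
      refine ((contDiffAt_comp_ratio hw N (ε * N) 1 h0.1).mul
        (contDiffAt_comp_ratio hw N (ε * N) 0 h0.2)).congr_of_eventuallyEq ?_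
      filter_upwards [continuousAt_const.eventually_lt hquot hs, hne] with y hy hyn
      have e : ∀ t : ℝ, ε * (N * t - ε * N) = N * (ε * t - 1) := fun t => by
        have : ε * (N * t - ε * N) = N * (ε * t - ε * ε) := by ring
        rw [this, hε2]
      have hle : ∀ t : ℝ, ε * t ≤ 1 → w (N * t - ε * N) = v (N * t - ε * N) := fun t ht =>
        hwv _ (by rw [e]; nlinarith)
      have hge : ∀ t : ℝ, 1 ≤ ε * t → w (N * t - ε * N) = 1 := fun t ht =>
        hw1 _ (by rw [e]; nlinarith)
      have habs : ∀ t : ℝ, 0 < ε * t → ε * t = |t| := fun t ht => by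
        rcases hε with rfl | rfl
        · rw [one_mul] at ht ⊢
          exact (abs_of_pos ht).symm
        · rw [abs_of_neg (by linarith)]
          ring
      have hy' : 0 < ε * (y 0 / y 1) := by
        have : ε * (y 0 / y 1) = (ε * ε) / (ε * (y 1 / y 0)) := by
          have := left_ne_zero_of_mul_eq_one hε2
          have h1 := hyn.1
          have h2 := hyn.2
          field_simp
        rw [this, hε2]
        exact one_div_pos.2 hy
      have p0 := abs_pos.2 hyn.1
      have p1 := abs_pos.2 hyn.2
      by_cases hc : |y 1| ≤ |y 0|
      · have i1 : ε * (y 1 / y 0) ≤ 1 := by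
          rw [habs _ hy, abs_div]
          exact (div_le_one p0).2 hc
        have i2 : 1 ≤ ε * (y 0 / y 1) := by
          rw [habs _ hy', abs_div]
          exact (one_le_div p1).2 hc
        simp [edgeFun, ratioFun, hc, hyn.1, hle _ i1, hge _ i2]
      · have i1 : 1 ≤ ε * (y 1 / y 0) := by
          rw [habs _ hy, abs_div]
          exact (one_le_div p0).2 (not_le.1 hc).le
        have i2 : ε * (y 0 / y 1) ≤ 1 := by
          rw [habs _ hy', abs_div]
          exact (div_le_one p1).2 (not_le.1 hc).le
        simp [edgeFun, ratioFun, hc, hyn.2, hge _ i1, hle _ i2]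
  · refine (contDiffAt_ratioFun hv hN0 (ε * N) (i := 0) (k := 1) h).congr_of_eventuallyEq ?_
    filter_upwards [(hca 1).continuousAt.eventually_lt (hca 0).continuousAt hlt] with y hy
    exact if_pos hy.le

variable {φ : 𝓢(ℝ, ℂ)} {α : ℕ → ℝ}

/-- The cone functions may be singular only at the origin, near which the corona function is zero.
-/
lemma contDiff_corona_mul (hφ : IsMeyerScaling φ) (hW : ContDiff ℝ ∞ (corona φ)) (j : ℕ)
    {V : Plane → ℂ} (hV : ∀ ξ : Plane, ξ 0 ≠ 0 ∨ ξ 1 ≠ 0 → ContDiffAt ℝ ∞ V ξ) :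
    ContDiff ℝ ∞ fun ξ => (corona φ (dil j • ξ) : ℂ) * V ξ := by
  refine contDiff_iff_contDiffAt.2 fun ξ => ?_
  by_cases h : ξ 0 ≠ 0 ∨ ξ 1 ≠ 0
  · have h1 : ContDiff ℝ ∞ fun ξ : Plane => corona φ (dil j • ξ) := hW.comp (by fun_prop)
    exact (Complex.ofRealCLM.contDiff.comp h1).contDiffAt.mul (hV ξ h)
  · have h0 : ξ = 0 := by
      push Not at h
      ext i
      fin_cases i
      exacts [h.1, h.2]
    subst h0
    refine (contDiffAt_const (c := (0 : ℂ))).congr_of_eventuallyEq ?_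
    filter_upwards [corona_eventually_eq_zero hφ (dil j)] with y hy
    simp [hy]

lemma contDiff_profile (hφ : IsMeyerScaling φ) (hv : IsBump v) (hα : IsScalingSequence α)
    (hW : ContDiff ℝ ∞ (corona φ)) (g : Gen α) : ContDiff ℝ ∞ (profile φ v α g) := by
  rcases g with _ | ⟨j, l | l | l⟩
  · exact Complex.ofRealCLM.contDiff.comp contDiff_scalHat
  · exact contDiff_corona_mul hφ hW j fun ξ h => contDiffAt_ratioFun hv (shearBound_pos _ _) _ h
  · exact contDiff_corona_mul hφ hW j fun ξ h =>
      contDiffAt_ratioFun hv (shearBound_pos _ _) _ h.symm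
  · refine contDiff_corona_mul hφ hW j fun ξ h => ?_
    obtain ⟨n, hn, hN⟩ := hα.exists_shearBound j
    have h1 : 1 ≤ shearBound (α j) j := by
      rw [hN]
      exact_mod_cast hn
    have hl : |(l.1 : ℝ)| = shearBound (α j) j := l.2
    rcases (abs_eq (by linarith)).1 hl with h2 | h2
    · rw [h2, ← one_mul (shearBound (α j) j)]
      simpa using contDiffAt_edgeFun hv h1 (Or.inl rfl) h
    · rw [h2]
      simpa using contDiffAt_edgeFun hv h1 (Or.inr rfl) h

lemma contDiff_genHat (hφ : IsMeyerScaling φ) (hv : IsBump v) (hα : IsScalingSequence α)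
    (hW : ContDiff ℝ ∞ (corona φ)) (p : Gen α × (Fin 2 → ℤ)) : ContDiff ℝ ∞ (genHat φ v α p) :=
  (contDiff_const.mul (contDiff_profile hφ hv hα hW p.1)).mul (contDiff_phase _ _)

lemma genHat_eventually_eq_zero (hφ : IsMeyerScaling φ) {p : Gen α × (Fin 2 → ℤ)}
    (hp : (indexEquiv α p).IsShearlet) : ∀ᶠ ξ in nhds (0 : Plane), genHat φ v α p ξ = 0 := by
  rcases p with ⟨_ | ⟨j, l | l | l⟩, k⟩
  · exact hp.elim
  all_goals
    filter_upwards [corona_eventually_eq_zero hφ (dil j)] with ξ h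
    simp [genHat, profile, h]

end Smooth

end UniversalShearlet

end

/-! ### Assembly of the main theorem -/

theorem mainTheorem1
    (φ : SchwartzMap ℝ ℂ) (hφ : UniversalShearlet.IsMeyerScaling φ)
    (v : ℝ → ℂ) (hv : UniversalShearlet.IsBump v)
    (α : ℕ → ℝ) (hα : UniversalShearlet.IsScalingSequence α) :
    (∃ h : ∀ i : UniversalShearlet.Index α,
        MemLp (UniversalShearlet.unish φ v α i) 2
          (volume : Measure UniversalShearlet.Plane),
      UniversalShearlet.IsParsevalFrame
        (fun i => (h i).toLp (UniversalShearlet.unish φ v α i)) ∧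
      ∀ i, UniversalShearlet.IsBandLimited
        ((h i).toLp (UniversalShearlet.unish φ v α i))) ∧
    (ContDiff ℝ ∞ (UniversalShearlet.corona φ) →
      (∀ i, UniversalShearlet.IsSchwartz (UniversalShearlet.unish φ v α i)) ∧
      ∀ i, i.IsShearlet →
        UniversalShearlet.HasInfinitelyManyVanishingMoments
          (UniversalShearlet.unish φ v α i)) := by
  open UniversalShearlet in
  have hmem : ∀ i : Index α, MemLp (unish φ v α i) 2 (volume : Measure Plane) := by
    intro i
    obtain ⟨p, rfl⟩ := (indexEquiv α).surjective i
    rw [unish_indexEquiv]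
    exact memLp_fourierInv (integrable_genHat hφ hv p) (memLp_genHat hφ hv p 2)
  have htoLp : ∀ p, (hmem (indexEquiv α p)).toLp (unish φ v α (indexEquiv α p))
      = (memLp_fourierInv (integrable_genHat hφ hv p) (memLp_genHat hφ hv p 2)).toLp
          (𝓕⁻ (genHat φ v α p)) := by
    intro p
    congr 1
    exact unish_indexEquiv p
  refine ⟨⟨hmem, ?_, ?_⟩, fun hW => ?_⟩
  · intro f
    -- By Plancherel, the frame identity for `f` is the Fourier-side identity for `𝓕 f`.
    rw [← (indexEquiv α).hasSum_iff, ← Lp.norm_fourier_eq f]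
    refine (isParsevalFrame_genHat hφ hv hα (𝓕 f)).congr_fun fun p => ?_
    simp only [Function.comp_apply]
    rw [htoLp,
      inner_toLp_fourierInv (integrable_genHat hφ hv p) (memLp_genHat hφ hv p 2)]
  · intro i
    obtain ⟨p, rfl⟩ := (indexEquiv α).surjective i
    refine ⟨tsupport (genHat φ v α p), hasCompactSupport_genHat hφ p, ?_⟩
    rw [htoLp, toLp_fourierInv (integrable_genHat hφ hv p) (memLp_genHat hφ hv p 2),
      FourierTransform.fourier_fourierInv_eq]
    filter_upwards [(memLp_genHat hφ hv p 2).coeFn_toLp] with ξ h hξ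
    rw [h]
    exact image_eq_zero_of_notMem_tsupport hξ
  -- Smooth `W` makes each transform smooth with compact support, hence Schwartz, and the inverse
  -- transform preserves the Schwartz space.
  · set H : Gen α × (Fin 2 → ℤ) → 𝓢(Plane, ℂ) := fun p =>
      (hasCompactSupport_genHat hφ p).toSchwartzMap (contDiff_genHat hφ hv hα hW p)
    have hH : ∀ p, ⇑(𝓕⁻ (H p) : 𝓢(Plane, ℂ)) = unish φ v α (indexEquiv α p) := fun p => by
      rw [unish_indexEquiv, SchwartzMap.fourierInv_coe]
      rfl
    refine ⟨fun i => ?_, fun i hi => ?_⟩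
    · obtain ⟨p, rfl⟩ := (indexEquiv α).surjective i
      exact ⟨𝓕⁻ (H p), hH p⟩
    · obtain ⟨p, rfl⟩ := (indexEquiv α).surjective i
      rw [← hH]
      refine hasInfinitelyManyVanishingMoments_of_fourier ?_
      rw [FourierTransform.fourier_fourierInv_eq]
      exact genHat_eventually_eq_zero hφ hi
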